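/- Let $M$ be a smooth, connected, Hausdorff manifold of dimension $n\ge 5$ with a smooth Lorentzian metric $g$ (signature $(-,+,\dots,+)$), let $\nabla$ be its Levi-Civita connection and $C_{jklm}$ its Weyl tensor. Suppose that $(M,g)$ is conformally recurrent with null recurrence vector, i.e. there is a smooth, nowhere vanishing covector field $\alpha$ on $M$ with $$\nabla_i C_{jklm}=\alpha_i\,C_{jklm},\qquad g^{ij}\alpha_i\alpha_j=0 .$$ Then at every point $x\in M$ the Weyl tensor is algebraically special, at least of type $\mathrm{II}_d$ in the Bel–Debever–Ortaggio classification. Explicitly, for every $x\in M$ there are null vectors $\ell,k\in T_xM$ with $g(\ell,k)=1$ such that, for all vectors $u,v,w\in T_xM$ orthogonal to both $\ell$ and $k$, $$C(\ell,u,\ell,v)=0,\qquad C(\ell,k,\ell,u)=0,\qquad C(\ell,u,v,w)=0$$ (all components of positive boost weight vanish: type II or more special, "algebraically special"), and moreover $$C(\ell,k,u,v)=0$$ (the component $C_{01ij}$ of boost weight $0$ vanishes: type $\mathrm{II}_d$ or more special). -/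

import Mathlib

open scoped Manifold ContDiff

noncomputable section

namespace ConfRec

/-- The model space `ℝⁿ`. -/
abbrev Eu (n : ℕ) : Type := EuclideanSpace ℝ (Fin n)

/-! ### Tensor calculus in a coordinate domain of `ℝⁿ`

`G` is the matrix `g_{ij}` of components of a metric, as a function of the coordinates. -/

section Local

variable {n : ℕ}

/-- The partial derivative `∂_i f` at `y`. -/
def pd (i : Fin n) (f : Eu n → ℝ) (y : Eu n) : ℝ :=
  fderiv ℝ f y (EuclideanSpace.single i 1)

/-- The Christoffel symbols of the Levi-Civita connection,
`christoffel G m i j y = Γ^m_{ij} = ½ g^{mp} (∂_i g_{pj} + ∂_j g_{pi} - ∂_p g_{ij})`. -/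
def christoffel (G : Eu n → Matrix (Fin n) (Fin n) ℝ) (m i j : Fin n) (y : Eu n) : ℝ :=
  (1 / 2) * ∑ p, (G y)⁻¹ m p *
    (pd i (fun z => G z p j) y + pd j (fun z => G z p i) y - pd p (fun z => G z i j) y)

/-- The Riemann tensor `R_{jkl}{}^m`, with the convention
`(∇_j ∇_k - ∇_k ∇_j) ω_l = R_{jkl}{}^m ω_m`. -/
def riemannUp (G : Eu n → Matrix (Fin n) (Fin n) ℝ) (j k l m : Fin n) (y : Eu n) : ℝ :=
  pd k (christoffel G m j l) y - pd j (christoffel G m k l) y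
    + ∑ p, (christoffel G p j l y * christoffel G m k p y
        - christoffel G p k l y * christoffel G m j p y)

/-- The Riemann tensor `R_{jklm} = R_{jkl}{}^p g_{pm}`. -/
def riemann (G : Eu n → Matrix (Fin n) (Fin n) ℝ) (j k l m : Fin n) (y : Eu n) : ℝ :=
  ∑ p, riemannUp G j k l p y * G y p m

/-- The Ricci tensor `R_{kl} = -R_{mkl}{}^m`. -/
def ricci (G : Eu n → Matrix (Fin n) (Fin n) ℝ) (k l : Fin n) (y : Eu n) : ℝ :=
  -∑ m, riemannUp G m k l m y

/-- The scalar curvature `R = g^{ij} R_{ij}`. -/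
def scalarCurv (G : Eu n → Matrix (Fin n) (Fin n) ℝ) (y : Eu n) : ℝ :=
  ∑ i, ∑ j, (G y)⁻¹ i j * ricci G i j y

/-- The components `C_{jklm}` of the Weyl tensor. -/
def weyl (G : Eu n → Matrix (Fin n) (Fin n) ℝ) (j k l m : Fin n) (y : Eu n) : ℝ :=
  riemann G j k l m y
    + (1 / ((n : ℝ) - 2)) *
      (G y j m * ricci G k l y - G y k m * ricci G j l y
        + ricci G j m y * G y k l - ricci G k m y * G y j l)
    - scalarCurv G y * (G y j m * G y k l - G y k m * G y j l)
        / (((n : ℝ) - 1) * ((n : ℝ) - 2))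

/-- The components `∇_i C_{jklm}` of the covariant derivative of the Weyl tensor. -/
def covWeyl (G : Eu n → Matrix (Fin n) (Fin n) ℝ) (i j k l m : Fin n) (y : Eu n) : ℝ :=
  pd i (weyl G j k l m) y
    - ∑ p, (christoffel G p i j y * weyl G p k l m y + christoffel G p i k y * weyl G j p l m y
        + christoffel G p i l y * weyl G j k p m y + christoffel G p i m y * weyl G j k l p y)

end Local

/-! ### Pseudo-Riemannian manifolds -/

section Manifold

variable (n : ℕ) (M : Type*) [TopologicalSpace M] [ChartedSpace (Eu n) M]
  [IsManifold 𝓘(ℝ, Eu n) ∞ M]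

/-- A smooth pseudo-Riemannian metric on the `n`-dimensional manifold `M`. -/
structure PseudoMetric where
  /-- The scalar product on the tangent spaces. -/
  val (x : M) : TangentSpace 𝓘(ℝ, Eu n) x →L[ℝ] TangentSpace 𝓘(ℝ, Eu n) x →L[ℝ] ℝ
  symm (x : M) (v w : TangentSpace 𝓘(ℝ, Eu n) x) : val x v w = val x w v
  nondegenerate (x : M) (v : TangentSpace 𝓘(ℝ, Eu n) x) (hv : ∀ w, val x v w = 0) : v = 0
  contMDiff : ContMDiff 𝓘(ℝ, Eu n) (𝓘(ℝ, Eu n).prod 𝓘(ℝ, Eu n →L[ℝ] Eu n →L[ℝ] ℝ)) ∞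
    (fun x => Bundle.TotalSpace.mk' (Eu n →L[ℝ] Eu n →L[ℝ] ℝ)
      (E := fun x : M => TangentSpace 𝓘(ℝ, Eu n) x →L[ℝ] TangentSpace 𝓘(ℝ, Eu n) x →L[ℝ] ℝ)
      x (val x))

/-- A smooth covector field on the `n`-dimensional manifold `M`. -/
structure CovectorField where
  /-- The value of the field at a point. -/
  val (x : M) : TangentSpace 𝓘(ℝ, Eu n) x →L[ℝ] ℝ
  contMDiff : ContMDiff 𝓘(ℝ, Eu n) (𝓘(ℝ, Eu n).prod 𝓘(ℝ, Eu n →L[ℝ] ℝ)) ∞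
    (fun x => Bundle.TotalSpace.mk' (Eu n →L[ℝ] ℝ)
      (E := fun x : M => TangentSpace 𝓘(ℝ, Eu n) x →L[ℝ] ℝ) x (val x))

variable {n M}

/-- The coordinate vector `∂_i` of the chart `φ` at the point with coordinates `y`. -/
def coordVec (φ : OpenPartialHomeomorph M (Eu n)) (i : Fin n) (y : Eu n) :
    TangentSpace 𝓘(ℝ, Eu n) (φ.symm y) :=
  mfderiv 𝓘(ℝ, Eu n) 𝓘(ℝ, Eu n) φ.symm y (EuclideanSpace.single i (1 : ℝ) : Eu n)

/-- The components `g_{ij} = g(∂_i, ∂_j)` of the metric in the chart `φ`. -/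
def PseudoMetric.comp (g : PseudoMetric n M) (φ : OpenPartialHomeomorph M (Eu n)) (y : Eu n) :
    Matrix (Fin n) (Fin n) ℝ :=
  Matrix.of fun i j => g.val (φ.symm y) (coordVec φ i y) (coordVec φ j y)

/-- The components `α_i = α(∂_i)` of a covector field in the chart `φ`. -/
def CovectorField.comp (α : CovectorField n M) (φ : OpenPartialHomeomorph M (Eu n))
    (i : Fin n) (y : Eu n) : ℝ :=
  α.val (φ.symm y) (coordVec φ i y)

/-- The component `v^i` in the chart `φ` of a tangent vector at `x`. -/
def vecComp (φ : OpenPartialHomeomorph M (Eu n)) (x : M) (v : TangentSpace 𝓘(ℝ, Eu n) x)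
    (i : Fin n) : ℝ :=
  (show Eu n from mfderiv 𝓘(ℝ, Eu n) 𝓘(ℝ, Eu n) φ x v) i

/-- The Weyl tensor at the point `x` as a function of four tangent vectors,
`C(u, v, w, z) = C_{jklm} u^j v^k w^l z^m`, computed in the chart `φ` around `x`. -/
def PseudoMetric.weylAt (g : PseudoMetric n M) (φ : OpenPartialHomeomorph M (Eu n)) (x : M)
    (u v w z : TangentSpace 𝓘(ℝ, Eu n) x) : ℝ :=
  ∑ j, ∑ k, ∑ l, ∑ m, weyl (g.comp φ) j k l m (φ x) *
    vecComp φ x u j * vecComp φ x v k * vecComp φ x w l * vecComp φ x z m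

/-- The metric is Lorentzian (signature `(-, +, …, +)`): every tangent space contains a time-like
vector whose orthogonal complement is positive definite. -/
def PseudoMetric.IsLorentzian (g : PseudoMetric n M) : Prop :=
  ∀ x : M, ∃ t : TangentSpace 𝓘(ℝ, Eu n) x, g.val x t t < 0 ∧
    ∀ v : TangentSpace 𝓘(ℝ, Eu n) x, g.val x t v = 0 → v ≠ 0 → 0 < g.val x v v

/-- `(M, g)` is conformally recurrent with recurrence vector `α`: the covector field `α` is
non-zero and `∇_i C_{jklm} = α_i C_{jklm}` in every local coordinate system. -/
def PseudoMetric.IsConformallyRecurrent (g : PseudoMetric n M) (α : CovectorField n M) : Prop :=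
  (∀ x : M, α.val x ≠ 0) ∧
  ∀ φ ∈ IsManifold.maximalAtlas 𝓘(ℝ, Eu n) ∞ M, ∀ y ∈ φ.target, ∀ i j k l m : Fin n,
    covWeyl (g.comp φ) i j k l m y = α.comp φ i y * weyl (g.comp φ) j k l m y

/-- The covector field `α` is null, `g^{ij} α_i α_j = 0`: at every point, the tangent vector `a`
that is metrically equivalent to `α` satisfies `g(a, a) = 0`. -/
def PseudoMetric.IsNullField (g : PseudoMetric n M) (α : CovectorField n M) : Prop :=
  ∀ x : M, ∃ a : TangentSpace 𝓘(ℝ, Eu n) x, (∀ v, g.val x a v = α.val x v) ∧ g.val x a a = 0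

/-- `l, k` are the two null vectors of a null frame `(l, k, m_2, …, m_{n-1})` at `x`. The space-like
vectors `m_i` of such a frame span the space of all vectors orthogonal to `l` and `k`. -/
def PseudoMetric.IsNullPair (g : PseudoMetric n M) (x : M)
    (l k : TangentSpace 𝓘(ℝ, Eu n) x) : Prop :=
  g.val x l l = 0 ∧ g.val x k k = 0 ∧ g.val x l k = 1

/-- `v` lies in the transverse space of the null pair `l, k`: it is orthogonal to both. -/
def PseudoMetric.IsTransverse (g : PseudoMetric n M) (x : M)
    (l k v : TangentSpace 𝓘(ℝ, Eu n) x) : Prop :=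
  g.val x l v = 0 ∧ g.val x k v = 0

/-- The components of the Weyl tensor of positive boost weight with respect to the null pair `l, k`
vanish: `C_{0i0j} = 0` (boost weight `2`), `C_{010i} = 0` and `C_{0ijk} = 0` (boost weight `1`).
Here the frame indices `0`, `1` and `i, j, k ≥ 2` stand for `l`, `k` and the transverse vectors.
Thus `l` is a multiple Weyl aligned null direction. -/
def PseudoMetric.BoostPosVanish (g : PseudoMetric n M) (x : M)
    (l k : TangentSpace 𝓘(ℝ, Eu n) x) : Prop :=
  ∀ φ ∈ IsManifold.maximalAtlas 𝓘(ℝ, Eu n) ∞ M, x ∈ φ.source →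
    (∀ u v, g.IsTransverse x l k u → g.IsTransverse x l k v → g.weylAt φ x l u l v = 0) ∧
    (∀ u, g.IsTransverse x l k u → g.weylAt φ x l k l u = 0) ∧
    (∀ u v w, g.IsTransverse x l k u → g.IsTransverse x l k v → g.IsTransverse x l k w →
      g.weylAt φ x l u v w = 0)

/-- The component `C_{01ij}` of boost weight `0` of the Weyl tensor vanishes, for the null pair
`l, k`. Since `C_{01ij} = C_{0i1j} - C_{0j1i}`, this says that the matrix `C_{0i1j}` is symmetric. -/
def PseudoMetric.AntisymVanish (g : PseudoMetric n M) (x : M)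
    (l k : TangentSpace 𝓘(ℝ, Eu n) x) : Prop :=
  ∀ φ ∈ IsManifold.maximalAtlas 𝓘(ℝ, Eu n) ∞ M, x ∈ φ.source →
    ∀ u v, g.IsTransverse x l k u → g.IsTransverse x l k v → g.weylAt φ x l k u v = 0

/-- The Weyl tensor at `x` is algebraically special: of type II or more special. -/
def PseudoMetric.IsAlgSpecialAt (g : PseudoMetric n M) (x : M) : Prop :=
  ∃ l k : TangentSpace 𝓘(ℝ, Eu n) x, g.IsNullPair x l k ∧ g.BoostPosVanish x l k

/-- The Weyl tensor at `x` is of type `II_d` or more special. -/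
def PseudoMetric.IsAtLeastTypeIIdAt (g : PseudoMetric n M) (x : M) : Prop :=
  ∃ l k : TangentSpace 𝓘(ℝ, Eu n) x, g.IsNullPair x l k ∧ g.BoostPosVanish x l k ∧
    g.AntisymVanish x l k

end Manifold

end ConfRec

end

/-! The second Bianchi identity makes the cyclic sum of `∇_i C_{jklm}` over `i, j, k` a sum of
products of the metric with a tensor `P` (a multiple of the Cotton tensor): `weyl_bianchi`.
Recurrence replaces `∇C` by `α ⊗ C`, so what remains is a pointwise algebraic condition. Contracting
it, with `C` trace-free, gives `(3 - n) P_{jkl} = C_{jklp} a^p`, where `a` is the vector dual to `α`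
(`cyclic_trace_part`). Thus `P` can be eliminated, leaving an identity in `C`, `g` and `a` alone
(`tensorEval_cyclic_identity`).

The null vector `a` is itself the multiple aligned direction. Complete it to a null pair `a, k` and
evaluate the identity on vectors adapted to the pair (`typeIId_of_cyclic_identity`). Writing `e` for
`a` and `q` for `k`: in weight 2 the normalised values `C(e,j,e,j)` have vanishing pairwise sums
over three mutually orthogonal transverse directions, so each is zero. In weight 1, `C(e,u,v,w)` is
expressed by `C(e,q,e,·)`, and a second evaluation kills the latter. In weight 0 the antisymmetric
part of `C(e,u,q,v)` is multiplied by `4 - n`. Three orthogonal transverse directions and `n ≠ 4`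
are where `n ≥ 5` enters. Transverse vectors are space-like (`pos_of_orthogonal_null_pair`), so one
may divide by their squares. -/

namespace ConfRec

/-! ### Partial derivatives, connection matrices and symmetries of the Riemann tensor. -/

section LocalCalculus

variable {n : ℕ}

theorem pd_add (i : Fin n) {f g : Eu n → ℝ} {y : Eu n} (hf : DifferentiableAt ℝ f y)
    (hg : DifferentiableAt ℝ g y) : pd i (fun z => f z + g z) y = pd i f y + pd i g y := by
  simp [pd, fderiv_fun_add hf hg]

theorem pd_sub (i : Fin n) {f g : Eu n → ℝ} {y : Eu n} (hf : DifferentiableAt ℝ f y)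
    (hg : DifferentiableAt ℝ g y) : pd i (fun z => f z - g z) y = pd i f y - pd i g y := by
  simp [pd, fderiv_fun_sub hf hg]

theorem pd_mul (i : Fin n) {f g : Eu n → ℝ} {y : Eu n} (hf : DifferentiableAt ℝ f y)
    (hg : DifferentiableAt ℝ g y) :
    pd i (fun z => f z * g z) y = pd i f y * g y + f y * pd i g y := by
  simp only [pd, fderiv_fun_mul hf hg, _root_.add_apply, _root_.smul_apply,
    smul_eq_mul]
  ring

theorem pd_const_mul (i : Fin n) (c : ℝ) {f : Eu n → ℝ} {y : Eu n}
    (hf : DifferentiableAt ℝ f y) : pd i (fun z => c * f z) y = c * pd i f y := by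
  simp [pd, fderiv_const_mul hf]

theorem pd_sum {ι : Type*} (s : Finset ι) (i : Fin n) {f : ι → Eu n → ℝ} {y : Eu n}
    (hf : ∀ a ∈ s, DifferentiableAt ℝ (f a) y) :
    pd i (fun z => ∑ a ∈ s, f a z) y = ∑ a ∈ s, pd i (f a) y := by
  simp [pd, fderiv_fun_sum hf]

theorem pd_congr (i : Fin n) {f g : Eu n → ℝ} {y : Eu n} (h : f =ᶠ[nhds y] g) :
    pd i f y = pd i g y := by
  simp [pd, h.fderiv_eq]

theorem contDiffAt_pd (i : Fin n) {f : Eu n → ℝ} {y : Eu n} (hf : ContDiffAt ℝ ∞ f y) :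
    ContDiffAt ℝ ∞ (pd i f) y :=
  (hf.fderiv_right (m := ∞) (by simp)).clm_apply contDiffAt_const

theorem pd_comm (i j : Fin n) {f : Eu n → ℝ} {y : Eu n} (hf : ContDiffAt ℝ ∞ f y) :
    pd i (pd j f) y = pd j (pd i f) y := by
  have hd : DifferentiableAt ℝ (fderiv ℝ f) y :=
    (hf.fderiv_right (m := ∞) (by simp)).differentiableAt (by simp)
  have key : ∀ a b : Fin n, pd a (pd b f) y =
      fderiv ℝ (fderiv ℝ f) y (EuclideanSpace.single a 1) (EuclideanSpace.single b 1) := by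
    intro a b
    have : pd b f = fun z => fderiv ℝ f z (EuclideanSpace.single b 1) := rfl
    rw [this, pd, fderiv_clm_apply hd (differentiableAt_const _)]
    simp
  rw [key, key]
  exact (hf.isSymmSndFDerivAt
    (by simpa using WithTop.coe_le_coe.2 (le_top : (2 : ℕ∞) ≤ ⊤))) _ _

/-- A matrix-valued function with smooth entries at a point. -/
def SmoothMatAt (A : Eu n → Matrix (Fin n) (Fin n) ℝ) (y : Eu n) : Prop :=
  ∀ a b, ContDiffAt ℝ ∞ (fun z => A z a b) y

/-- The entrywise partial derivative of a matrix-valued function. -/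
noncomputable def pdMat (i : Fin n) (A : Eu n → Matrix (Fin n) (Fin n) ℝ) (y : Eu n) :
    Matrix (Fin n) (Fin n) ℝ :=
  Matrix.of fun a b => pd i (fun z => A z a b) y

section Mat

variable {A B : Eu n → Matrix (Fin n) (Fin n) ℝ} {y : Eu n}

theorem SmoothMatAt.diff (hA : SmoothMatAt A y) (a b : Fin n) :
    DifferentiableAt ℝ (fun z => A z a b) y :=
  (hA a b).differentiableAt (by simp)

theorem SmoothMatAt.add (hA : SmoothMatAt A y) (hB : SmoothMatAt B y) :
    SmoothMatAt (fun z => A z + B z) y := fun a b => (hA a b).add (hB a b)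

theorem SmoothMatAt.sub (hA : SmoothMatAt A y) (hB : SmoothMatAt B y) :
    SmoothMatAt (fun z => A z - B z) y := fun a b => (hA a b).sub (hB a b)

theorem SmoothMatAt.mul (hA : SmoothMatAt A y) (hB : SmoothMatAt B y) :
    SmoothMatAt (fun z => A z * B z) y := fun a b => by
  simp only [Matrix.mul_apply]
  exact ContDiffAt.sum fun c _ => (hA a c).mul (hB c b)

theorem SmoothMatAt.transpose (hA : SmoothMatAt A y) :
    SmoothMatAt (fun z => (A z).transpose) y := fun a b => hA b a

theorem SmoothMatAt.pdMat (i : Fin n) (hA : SmoothMatAt A y) :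
    SmoothMatAt (pdMat i A) y := fun a b => contDiffAt_pd i (hA a b)

theorem pdMat_add (i : Fin n) (hA : SmoothMatAt A y) (hB : SmoothMatAt B y) :
    pdMat i (fun z => A z + B z) y = pdMat i A y + pdMat i B y := by
  ext a b
  exact pd_add i (hA.diff a b) (hB.diff a b)

theorem pdMat_sub (i : Fin n) (hA : SmoothMatAt A y) (hB : SmoothMatAt B y) :
    pdMat i (fun z => A z - B z) y = pdMat i A y - pdMat i B y := by
  ext a b
  exact pd_sub i (hA.diff a b) (hB.diff a b)

theorem pdMat_mul (i : Fin n) (hA : SmoothMatAt A y) (hB : SmoothMatAt B y) :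
    pdMat i (fun z => A z * B z) y = pdMat i A y * B y + A y * pdMat i B y := by
  ext a b
  simp only [pdMat, Matrix.of_apply, Matrix.add_apply, Matrix.mul_apply]
  rw [pd_sum _ i (f := fun c z => A z a c * B z c b)
    fun c _ => (hA.diff a c).fun_mul (hB.diff c b), ← Finset.sum_add_distrib]
  exact Finset.sum_congr rfl fun c _ => pd_mul i (hA.diff a c) (hB.diff c b)

theorem pdMat_transpose (i : Fin n) :
    pdMat i (fun z => (A z).transpose) y = (pdMat i A y).transpose := rfl

theorem pdMat_comm (i j : Fin n) (hA : SmoothMatAt A y) :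
    pdMat i (pdMat j A) y = pdMat j (pdMat i A) y := by
  ext a b
  exact pd_comm i j (hA a b)

theorem pdMat_congr (i : Fin n) (h : A =ᶠ[nhds y] B) : pdMat i A y = pdMat i B y := by
  ext a b
  exact pd_congr i (h.mono fun z hz => congrFun (congrFun hz a) b)

theorem SmoothMatAt.det (hA : SmoothMatAt A y) : ContDiffAt ℝ ∞ (fun z => (A z).det) y := by
  simp only [Matrix.det_apply]
  refine ContDiffAt.sum fun σ _ => ContDiffAt.const_smul _ ?_
  exact contDiffAt_prod fun c _ => hA (σ c) c

theorem SmoothMatAt.inv (hA : SmoothMatAt A y) (hd : (A y).det ≠ 0) :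
    SmoothMatAt (fun z => (A z)⁻¹) y := fun a b => by
  -- Cramer's rule: each entry of the inverse is a quotient of determinants of matrices with smooth
  -- entries.
  simp only [Matrix.inv_def, Ring.inverse_eq_inv', Matrix.smul_apply, smul_eq_mul,
    Matrix.adjugate_apply]
  refine (hA.det.inv hd).mul ?_
  refine SmoothMatAt.det (A := fun z => (A z).updateRow b (Pi.single a 1)) fun c d => ?_
  by_cases h : c = b
  · subst h
    simpa using contDiffAt_const
  · simpa [Matrix.updateRow_ne h] using hA c d

end Mat

/-- `G` is the component matrix of a smooth metric on the open set `U`. -/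
structure IsMetricOn (G : Eu n → Matrix (Fin n) (Fin n) ℝ) (U : Set (Eu n)) : Prop where
  isOpen : IsOpen U
  symm : ∀ y i j, G y i j = G y j i
  smooth : ∀ y ∈ U, SmoothMatAt G y
  det_ne_zero : ∀ y ∈ U, (G y).det ≠ 0

/-- The connection matrix `(Γ_i)^m_l`. -/
noncomputable def connMat (G : Eu n → Matrix (Fin n) (Fin n) ℝ) (i : Fin n) (y : Eu n) :
    Matrix (Fin n) (Fin n) ℝ :=
  Matrix.of fun m l => christoffel G m i l y

/-- The curvature matrix whose entry at `(m, l)` is `R_{jkl}{}^m`. -/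
noncomputable def curvMat (G : Eu n → Matrix (Fin n) (Fin n) ℝ) (j k : Fin n) (y : Eu n) :
    Matrix (Fin n) (Fin n) ℝ :=
  Matrix.of fun m l => riemannUp G j k l m y

theorem curvMat_eq (G : Eu n → Matrix (Fin n) (Fin n) ℝ) (j k : Fin n) :
    curvMat G j k = fun y => pdMat k (connMat G j) y - pdMat j (connMat G k) y
      + (connMat G k y * connMat G j y - connMat G j y * connMat G k y) := by
  funext y
  ext m l
  simp only [curvMat, riemannUp, pdMat, connMat, Matrix.of_apply, Matrix.add_apply,
    Matrix.sub_apply, Matrix.mul_apply, Finset.sum_sub_distrib]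
  congr 2
  · exact Finset.sum_congr rfl fun p _ => mul_comm _ _
  · exact Finset.sum_congr rfl fun p _ => mul_comm _ _

theorem curvMat_swap (G : Eu n → Matrix (Fin n) (Fin n) ℝ) (j k : Fin n) (y : Eu n) :
    curvMat G k j y = -curvMat G j k y := by
  rw [curvMat_eq, curvMat_eq]
  noncomm_ring

theorem riemannUp_swap (G : Eu n → Matrix (Fin n) (Fin n) ℝ) (j k l m : Fin n) (y : Eu n) :
    riemannUp G k j l m y = -riemannUp G j k l m y :=
  congrFun (congrFun (curvMat_swap G j k y) m) l

namespace IsMetricOn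

variable {G : Eu n → Matrix (Fin n) (Fin n) ℝ} {U : Set (Eu n)} {y : Eu n}

theorem christoffel_symm (hG : IsMetricOn G U) (m i j : Fin n) :
    christoffel G m i j = christoffel G m j i := by
  funext y
  unfold christoffel
  congr 1
  refine Finset.sum_congr rfl fun p _ => ?_
  have : (fun z => G z i j) = fun z => G z j i := funext fun z => hG.symm z i j
  rw [this]
  ring

theorem isUnit_det (hG : IsMetricOn G U) (hy : y ∈ U) : IsUnit (G y).det :=
  isUnit_iff_ne_zero.2 (hG.det_ne_zero y hy)

theorem smooth_connMat (hG : IsMetricOn G U) (hy : y ∈ U) (i : Fin n) :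
    SmoothMatAt (connMat G i) y := fun m l => by
  have hs := hG.smooth y hy
  have hi := hs.inv (hG.det_ne_zero y hy)
  simp only [connMat, Matrix.of_apply, christoffel]
  refine contDiffAt_const.mul (ContDiffAt.sum fun p _ => (hi m p).mul ?_)
  exact ((contDiffAt_pd _ (hs p l)).add (contDiffAt_pd _ (hs p i))).sub (contDiffAt_pd _ (hs i l))

theorem smooth_curvMat (hG : IsMetricOn G U) (hy : y ∈ U) (j k : Fin n) :
    SmoothMatAt (curvMat G j k) y := by
  have hc := hG.smooth_connMat hy
  rw [curvMat_eq]
  exact ((hc j).pdMat k |>.sub ((hc k).pdMat j)).add (((hc k).mul (hc j)).sub ((hc j).mul (hc k)))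

theorem lower_christoffel (hG : IsMetricOn G U) (hy : y ∈ U) (q i j : Fin n) :
    ∑ m, G y q m * christoffel G m i j y =
      (1 / 2) * (pd i (fun z => G z q j) y + pd j (fun z => G z q i) y
        - pd q (fun z => G z i j) y) := by
  set v : Fin n → ℝ := fun p =>
    pd i (fun z => G z p j) y + pd j (fun z => G z p i) y - pd p (fun z => G z i j) y with hv
  have h1 : (fun m => christoffel G m i j y) = (1 / 2 : ℝ) • ((G y)⁻¹).mulVec v := by
    funext m
    simp [christoffel, Matrix.mulVec, dotProduct, hv]
  have h2 : (G y).mulVec (fun m => christoffel G m i j y) = (1 / 2 : ℝ) • v := by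
    rw [h1, Matrix.mulVec_smul, Matrix.mulVec_mulVec, Matrix.mul_nonsing_inv _ (hG.isUnit_det hy),
      Matrix.one_mulVec]
  exact congrFun h2 q

/-- This is `∇g = 0` in matrix form. Lowering the index of the two Christoffel symbols gives
first-kind symbols, whose antisymmetric parts cancel in the sum. -/
theorem metric_compat (hG : IsMetricOn G U) (hy : y ∈ U) (i : Fin n) :
    pdMat i G y = (connMat G i y).transpose * G y + G y * connMat G i y := by
  ext a b
  have h1 := hG.lower_christoffel hy a i b
  have h2 := hG.lower_christoffel hy b i a
  simp only [pdMat, Matrix.of_apply, Matrix.add_apply, Matrix.mul_apply, connMat,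
    Matrix.transpose_apply]
  have h3 : ∑ x, christoffel G x i a y * G y x b = ∑ x, G y b x * christoffel G x i a y :=
    Finset.sum_congr rfl fun x _ => by rw [hG.symm y x b, mul_comm]
  have h4 : (fun z => G z b a) = fun z => G z a b := funext fun z => hG.symm z b a
  have h5 : (fun z => G z i a) = fun z => G z a i := funext fun z => hG.symm z i a
  have h6 : (fun z => G z b i) = fun z => G z i b := funext fun z => hG.symm z b i
  rw [h3, h1, h2, h4, h5, h6]
  ring

theorem transpose_eq (hG : IsMetricOn G U) (y : Eu n) : (G y).transpose = G y := by
  ext a b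
  exact hG.symm y b a

/-- Differentiating `∇g = 0` once more and using that second partial derivatives of `g` commute
leaves exactly the curvature acting on `g`. -/
theorem curvMat_skew (hG : IsMetricOn G U) (hy : y ∈ U) (j k : Fin n) :
    (curvMat G j k y).transpose * G y + G y * curvMat G j k y = 0 := by
  have hs := hG.smooth y hy
  have hc := hG.smooth_connMat hy
  -- Compatibility is needed on a neighbourhood, not just at `y`, because it is about to be
  -- differentiated; this uses that `U` is open.
  have hnear : ∀ i, pdMat i G =ᶠ[nhds y]
      fun z => (connMat G i z).transpose * G z + G z * connMat G i z := fun i =>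
    Filter.eventually_of_mem (hG.isOpen.mem_nhds hy) fun z hz => hG.metric_compat hz i
  have hdd : ∀ a b : Fin n, pdMat a (pdMat b G) y =
      (pdMat a (connMat G b) y).transpose * G y
        + (connMat G b y).transpose * ((connMat G a y).transpose * G y + G y * connMat G a y)
        + (((connMat G a y).transpose * G y + G y * connMat G a y) * connMat G b y
          + G y * pdMat a (connMat G b) y) := by
    intro a b
    rw [pdMat_congr a (hnear b), pdMat_add a ((hc b).transpose.mul hs) (hs.mul (hc b)),
      pdMat_mul a (hc b).transpose hs, pdMat_mul a hs (hc b), pdMat_transpose,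
      hG.metric_compat hy a]
  have h := pdMat_comm k j hs
  rw [hdd, hdd] at h
  rw [curvMat_eq]
  simp only [Matrix.transpose_add, Matrix.transpose_sub, Matrix.transpose_mul]
  rw [← sub_eq_zero] at h
  rw [← h]
  noncomm_ring

theorem riemann_eq (hG : IsMetricOn G U) (j k l m : Fin n) (y : Eu n) :
    riemann G j k l m y = (G y * curvMat G j k y) m l := by
  simp only [riemann, Matrix.mul_apply, curvMat, Matrix.of_apply]
  exact Finset.sum_congr rfl fun p _ => by rw [hG.symm y p m, mul_comm]

theorem riemann_swap_left (G : Eu n → Matrix (Fin n) (Fin n) ℝ) (j k l m : Fin n) (y : Eu n) :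
    riemann G k j l m y = -riemann G j k l m y := by
  simp [riemann, riemannUp_swap G j k]

theorem riemann_swap_right (hG : IsMetricOn G U) (hy : y ∈ U) (j k l m : Fin n) :
    riemann G j k m l y = -riemann G j k l m y := by
  have h := congrFun (congrFun (hG.curvMat_skew hy j k) m) l
  rw [hG.riemann_eq, hG.riemann_eq]
  have h2 : ((curvMat G j k y).transpose * G y) m l = (G y * curvMat G j k y) l m := by
    rw [← Matrix.transpose_apply (G y * curvMat G j k y), Matrix.transpose_mul, hG.transpose_eq]
  simp only [Matrix.add_apply, h2, Matrix.zero_apply] at h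
  linarith

/-- Torsion-freeness: once the lower indices of `Γ` are put in a common order, the derivative terms
cancel in pairs and the quadratic terms cancel for each `p`. -/
theorem riemannUp_cyclic (hG : IsMetricOn G U) (j k l m : Fin n) (y : Eu n) :
    riemannUp G j k l m y + riemannUp G k l j m y + riemannUp G l j k m y = 0 := by
  simp only [riemannUp]
  rw [hG.christoffel_symm m l j, hG.christoffel_symm m k l, hG.christoffel_symm m j k]
  simp only [hG.christoffel_symm _ l j, hG.christoffel_symm _ k l, hG.christoffel_symm _ j k]
  have : ∀ f₁ f₂ f₃ : Fin n → ℝ, ∀ a b c : ℝ, (∀ p, f₁ p + f₂ p + f₃ p = 0) →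
      b - c + ∑ p, f₁ p + (a - b + ∑ p, f₂ p) + (c - a + ∑ p, f₃ p) = 0 := by
    intro f₁ f₂ f₃ a b c h
    have h' := Finset.sum_congr (rfl : Finset.univ = Finset.univ) fun p _ => h p
    simp only [Finset.sum_add_distrib, Finset.sum_const_zero] at h'
    linarith
  apply this
  intro p
  ring

theorem riemann_cyclic (hG : IsMetricOn G U) (j k l m : Fin n) (y : Eu n) :
    riemann G j k l m y + riemann G k l j m y + riemann G l j k m y = 0 := by
  simp only [riemann, ← Finset.sum_add_distrib, ← add_mul, hG.riemannUp_cyclic, zero_mul,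
    Finset.sum_const_zero]

/-- The octahedron argument: add the four cyclic identities in which each index in turn occupies the
last slot, and simplify with skewness in both pairs. -/
theorem riemann_pair_symm (hG : IsMetricOn G U) (hy : y ∈ U) (j k l m : Fin n) :
    riemann G l m j k y = riemann G j k l m y := by
  have c := fun a b c d => hG.riemann_cyclic a b c d y
  have s := fun a b c d => riemann_swap_left G a b c d y
  have r := fun a b c d => hG.riemann_swap_right hy a b c d
  linarith [c j k l m, c k l m j, c l m j k, c m j k l, s j k l m, s l m j k, s j m k l,
    s k l m j, s l j k m, s m k l j, r j k l m, r k l j m, r l j k m, r k l m j, r l m k j,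
    r m k l j, r l m j k, r m j l k, r j l m k, r m j k l, r j k m l, r k m j l,
    s k m j l, s j l m k, s l j m k, s m k j l]

end IsMetricOn

end LocalCalculus

/-! ### Metric traces and the contracted cyclic identity. -/

section Trace

variable {n : ℕ}

/-- The trace `g^{ij} T_{ij}`. -/
noncomputable def mtrace (g : Matrix (Fin n) (Fin n) ℝ) (T : Fin n → Fin n → ℝ) : ℝ :=
  ∑ i, ∑ j, g⁻¹ i j * T i j

variable {g : Matrix (Fin n) (Fin n) ℝ}

theorem mtrace_add (S T : Fin n → Fin n → ℝ) :
    mtrace g (fun i j => S i j + T i j) = mtrace g S + mtrace g T := by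
  simp [mtrace, mul_add, Finset.sum_add_distrib]

theorem mtrace_sub (S T : Fin n → Fin n → ℝ) :
    mtrace g (fun i j => S i j - T i j) = mtrace g S - mtrace g T := by
  simp [mtrace, mul_sub, Finset.sum_sub_distrib]

theorem mtrace_neg (T : Fin n → Fin n → ℝ) :
    mtrace g (fun i j => -T i j) = -mtrace g T := by
  simp [mtrace]

theorem mtrace_const_mul (c : ℝ) (T : Fin n → Fin n → ℝ) :
    mtrace g (fun i j => c * T i j) = c * mtrace g T := by
  simp only [mtrace, Finset.mul_sum]
  exact Finset.sum_congr rfl fun i _ => Finset.sum_congr rfl fun j _ => by ring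

theorem mtrace_mul_const (c : ℝ) (T : Fin n → Fin n → ℝ) :
    mtrace g (fun i j => T i j * c) = mtrace g T * c := by
  simp only [mul_comm _ c]
  exact mtrace_const_mul c T

theorem mtrace_sum (T : Fin n → Fin n → Fin n → ℝ) :
    mtrace g (fun i j => ∑ p, T p i j) = ∑ p, mtrace g (T p) := by
  simp only [mtrace, Finset.mul_sum]
  rw [Finset.sum_comm' (t' := Finset.univ) (s' := fun _ => Finset.univ) (by simp)]
  rw [Finset.sum_comm]
  conv_rhs => rw [Finset.sum_comm]
  refine Finset.sum_congr rfl fun i _ => ?_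
  rw [Finset.sum_comm]

theorem inv_symm (hs : ∀ i j, g i j = g j i) (i j : Fin n) : g⁻¹ i j = g⁻¹ j i := by
  have hg : g.transpose = g := by
    ext a b
    exact hs b a
  have := Matrix.transpose_nonsing_inv g
  rw [hg] at this
  exact congrFun (congrFun this j) i

theorem mtrace_swap (hs : ∀ i j, g i j = g j i) (T : Fin n → Fin n → ℝ) :
    mtrace g (fun i j => T j i) = mtrace g T := by
  simp only [mtrace]
  rw [Finset.sum_comm]
  exact Finset.sum_congr rfl fun i _ => Finset.sum_congr rfl fun j _ => by
    rw [inv_symm hs]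

variable (hs : ∀ i j, g i j = g j i) (hd : IsUnit g.det)
include hd

theorem sum_inv_mul (i k : Fin n) : ∑ j, g⁻¹ i j * g j k = if i = k then 1 else 0 := by
  rw [← Matrix.mul_apply, Matrix.nonsing_inv_mul _ hd, Matrix.one_apply]

include hs

theorem mtrace_metric_right (k : Fin n) (f : Fin n → ℝ) :
    mtrace g (fun i j => g k j * f i) = f k := by
  have : ∀ i, ∑ j, g⁻¹ i j * (g k j * f i) = if i = k then f i else 0 := by
    intro i
    have h := sum_inv_mul hd i k
    simp only [hs k, ← mul_assoc, ← Finset.sum_mul, h]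
    split_ifs <;> simp
  simp [mtrace, this]

theorem mtrace_metric_left (k : Fin n) (f : Fin n → ℝ) :
    mtrace g (fun i j => g k i * f j) = f k := by
  rw [mtrace_swap hs (fun j i => g k i * f j)]
  exact mtrace_metric_right hs hd k f

theorem mtrace_metric : mtrace g (fun i j => g i j) = n := by
  have : ∀ i, ∑ j, g⁻¹ i j * g i j = 1 := by
    intro i
    have h := sum_inv_mul hd i i
    simp only [hs i]
    simpa using h
  simp [mtrace, this]

theorem mtrace_metric_mul (c : ℝ) : mtrace g (fun i j => g i j * c) = n * c :=
  (mtrace_mul_const c fun i j => g i j).trans (by rw [mtrace_metric hs hd])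

/-- A trace-free tensor `C` with the symmetries of a curvature tensor, whose product with a covector
`α` has a cyclic sum of pure trace type, satisfies the contracted form of that identity. -/
theorem cyclic_trace_part (hn : 3 < n) {C : Fin n → Fin n → Fin n → Fin n → ℝ}
    {P : Fin n → Fin n → Fin n → ℝ} {α a : Fin n → ℝ}
    (hl : ∀ j k l m, C k j l m = -C j k l m) (hr : ∀ j k l m, C j k m l = -C j k l m)
    (ht : ∀ k l, mtrace g (fun j m => C j k l m) = 0)
    (hP : ∀ i k l, P k i l = -P i k l) (ha : ∀ i, α i = ∑ p, g p i * a p)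
    (H : ∀ i j k l m, α i * C j k l m + α j * C k i l m + α k * C i j l m =
      g j m * P i k l + g k m * P j i l + g i m * P k j l
        - g j l * P i k m - g k l * P j i m - g i l * P k j m) (j k l : Fin n) :
    (3 - (n : ℝ)) * P j k l = ∑ p, C j k l p * a p := by
  set t : Fin n → ℝ := fun k => mtrace g (fun i m => P i k m) with ht_def
  -- Contraction of `H` with `g^{im}`: two terms on the left vanish since `C` is trace-free, and `α`
  -- becomes `a`. The trace `t` of `P` still appears.
  have e1 : ∀ j k l, ∑ p, C j k l p * a p =
      (3 - (n : ℝ)) * P j k l - g j l * t k + g k l * t j := by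
    intro j k l
    have h : mtrace g (fun i m => α i * C j k l m + α j * C k i l m + α k * C i j l m) =
        mtrace g (fun i m => g j m * P i k l + g k m * P j i l + g i m * P k j l
          - g j l * P i k m - g k l * P j i m - g i l * P k j m) := by
      simp only [H]
    have h1 : mtrace g (fun i m => α i * C j k l m) = ∑ p, C j k l p * a p := by
      simp only [ha, Finset.sum_mul]
      rw [mtrace_sum]
      refine Finset.sum_congr rfl fun p _ => ?_
      have : (fun i m => g p i * a p * C j k l m) = fun i m => a p * (g p i * C j k l m) := by
        funext i m
        ring
      rw [this, mtrace_const_mul, mtrace_metric_left hs hd]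
      ring
    have h2 : mtrace g (fun i m => α j * C k i l m) = 0 := by
      simp only [hl _ k, mul_neg]
      rw [mtrace_neg, mtrace_const_mul, ht]
      simp
    have h3 : mtrace g (fun i m => α k * C i j l m) = 0 := by
      rw [mtrace_const_mul, ht]
      simp
    have h4 : mtrace g (fun i m => g j l * P i k m) = g j l * t k := mtrace_const_mul _ _
    have h5 : mtrace g (fun i m => g k l * P j i m) = -(g k l * t j) := by
      simp only [hP _ j, mul_neg]
      rw [mtrace_neg, mtrace_const_mul]
    have h6 : mtrace g (fun i m => g i l * P k j m) = P k j l := by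
      simp only [hs _ l]
      exact mtrace_metric_left hs hd l _
    have h7 : mtrace g (fun i m => g i m * P k j l) = n * P k j l :=
      mtrace_metric_mul hs hd _
    simp only [mtrace_sub, mtrace_add] at h
    rw [h1, h2, h3, h4, h5, h6, h7, mtrace_metric_right hs hd j fun i => P i k l,
      mtrace_metric_right hs hd k fun i => P j i l, hP j k l] at h
    linarith
  -- A second contraction, with `g^{jl}`, kills the left side of `e1` and gives `(4 - 2n) t = 0`.
  have e2 : ∀ k, t k = 0 := by
    intro k
    have h : mtrace g (fun j l => ∑ p, C j k l p * a p) =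
        mtrace g (fun j l => (3 - (n : ℝ)) * P j k l - g j l * t k + g k l * t j) := by
      simp only [e1]
    have h1 : mtrace g (fun j l => ∑ p, C j k l p * a p) = 0 := by
      rw [mtrace_sum]
      refine Finset.sum_eq_zero fun p _ => ?_
      simp only [hr _ _ p]
      rw [mtrace_mul_const, mtrace_neg, ht]
      simp
    rw [h1, mtrace_add, mtrace_sub, mtrace_const_mul, mtrace_metric_mul hs hd,
      mtrace_metric_right hs hd] at h
    have hn' : (3 : ℝ) < n := by exact_mod_cast hn
    have h' : (4 - 2 * (n : ℝ)) * t k = 0 := by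
      rw [ht_def] at h ⊢
      linarith
    rcases mul_eq_zero.1 h' with h' | h'
    · linarith
    · exact h'
  rw [e1, e2, e2]
  ring

end Trace

/-! ### The Weyl tensor: symmetries, trace-freeness and Bianchi identities. -/

section WeylTensor

variable {n : ℕ}

/-- The covariant derivative of a covariant tensor of rank two. -/
noncomputable def covTwo (G : Eu n → Matrix (Fin n) (Fin n) ℝ) (i : Fin n)
    (T : Fin n → Fin n → Eu n → ℝ) (j k : Fin n) (y : Eu n) : ℝ :=
  pd i (T j k) y - ∑ p, (christoffel G p i j y * T p k y + christoffel G p i k y * T j p y)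

/-- The covariant derivative of a covariant tensor of rank four. -/
noncomputable def covFour (G : Eu n → Matrix (Fin n) (Fin n) ℝ) (i : Fin n)
    (T : Fin n → Fin n → Fin n → Fin n → Eu n → ℝ) (j k l m : Fin n) (y : Eu n) : ℝ :=
  pd i (T j k l m) y
    - ∑ p, (christoffel G p i j y * T p k l m y + christoffel G p i k y * T j p l m y
        + christoffel G p i l y * T j k p m y + christoffel G p i m y * T j k l p y)

variable {G : Eu n → Matrix (Fin n) (Fin n) ℝ} {y : Eu n}

theorem covFour_add (i j k l m : Fin n) {S T : Fin n → Fin n → Fin n → Fin n → Eu n → ℝ}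
    (hS : DifferentiableAt ℝ (S j k l m) y) (hT : DifferentiableAt ℝ (T j k l m) y) :
    covFour G i (fun j k l m z => S j k l m z + T j k l m z) j k l m y =
      covFour G i S j k l m y + covFour G i T j k l m y := by
  simp only [covFour]
  rw [pd_add i hS hT, sub_add_sub_comm, ← Finset.sum_add_distrib]
  congr 1
  exact Finset.sum_congr rfl fun p _ => by ring

theorem covFour_sub (i j k l m : Fin n) {S T : Fin n → Fin n → Fin n → Fin n → Eu n → ℝ}
    (hS : DifferentiableAt ℝ (S j k l m) y) (hT : DifferentiableAt ℝ (T j k l m) y) :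
    covFour G i (fun j k l m z => S j k l m z - T j k l m z) j k l m y =
      covFour G i S j k l m y - covFour G i T j k l m y := by
  simp only [covFour]
  rw [pd_sub i hS hT, sub_sub_sub_comm, ← Finset.sum_sub_distrib]
  congr 1
  exact Finset.sum_congr rfl fun p _ => by ring

theorem covFour_const_mul (i j k l m : Fin n) (c : ℝ)
    {T : Fin n → Fin n → Fin n → Fin n → Eu n → ℝ} (hT : DifferentiableAt ℝ (T j k l m) y) :
    covFour G i (fun j k l m z => c * T j k l m z) j k l m y = c * covFour G i T j k l m y := by
  simp only [covFour]
  rw [pd_const_mul i c hT, mul_sub, Finset.mul_sum]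
  congr 1
  exact Finset.sum_congr rfl fun p _ => by ring

/-- The Leibniz rule. Both index placements, `jm|kl` here and `km|jl` below, occur among the four
products of the metric and Schouten tensors in the Weyl tensor. -/
theorem covFour_outer (i j k l m : Fin n) {S T : Fin n → Fin n → Eu n → ℝ}
    (hS : DifferentiableAt ℝ (S j m) y) (hT : DifferentiableAt ℝ (T k l) y) :
    covFour G i (fun j k l m z => S j m z * T k l z) j k l m y =
      covTwo G i S j m y * T k l y + S j m y * covTwo G i T k l y := by
  simp only [covFour, covTwo]
  rw [pd_mul i hS hT, sub_mul, mul_sub, sub_add_sub_comm, Finset.sum_mul, Finset.mul_sum,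
    ← Finset.sum_add_distrib]
  congr 1
  exact Finset.sum_congr rfl fun p _ => by ring

theorem covFour_outer' (i j k l m : Fin n) {S T : Fin n → Fin n → Eu n → ℝ}
    (hS : DifferentiableAt ℝ (S k m) y) (hT : DifferentiableAt ℝ (T j l) y) :
    covFour G i (fun j k l m z => S k m z * T j l z) j k l m y =
      covTwo G i S k m y * T j l y + S k m y * covTwo G i T j l y := by
  simp only [covFour, covTwo]
  rw [pd_mul i hS hT, sub_mul, mul_sub, sub_add_sub_comm, Finset.sum_mul, Finset.mul_sum,
    ← Finset.sum_add_distrib]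
  congr 1
  exact Finset.sum_congr rfl fun p _ => by ring

/-- The tensor `R_{kl} - R g_{kl} / (2 (n - 1))`, a multiple of the Schouten tensor. -/
noncomputable def schouten (G : Eu n → Matrix (Fin n) (Fin n) ℝ) (k l : Fin n) (y : Eu n) : ℝ :=
  ricci G k l y - 1 / (2 * ((n : ℝ) - 1)) * (scalarCurv G y * G y k l)

/-- The scalar curvature term splits evenly over the metric–Ricci products. In this form, since `∇g
= 0`, covariant differentiation touches only `riemann` and `schouten`. -/
theorem weyl_eq (hn : 2 < n) (j k l m : Fin n) : weyl G j k l m = fun y => riemann G j k l m y +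
    1 / ((n : ℝ) - 2) * (G y j m * schouten G k l y - G y k m * schouten G j l y
      + schouten G j m y * G y k l - schouten G k m y * G y j l) := by
  have hn' : (2 : ℝ) < n := by exact_mod_cast hn
  have h1 : (n : ℝ) - 1 ≠ 0 := by linarith
  have h2 : (n : ℝ) - 2 ≠ 0 := by linarith
  funext y
  simp only [weyl, schouten]
  field_simp
  ring

namespace IsMetricOn

variable {U : Set (Eu n)}

theorem riemann_trace (hG : IsMetricOn G U) (hy : y ∈ U) (k l : Fin n) :
    mtrace (G y) (fun j m => riemann G j k l m y) = -ricci G k l y := by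
  simp only [riemann, ricci, neg_neg]
  rw [mtrace_sum]
  refine Finset.sum_congr rfl fun p _ => ?_
  simp only [mul_comm _ (G y p _)]
  exact mtrace_metric_right (hG.symm y) (hG.isUnit_det hy) p fun j => riemannUp G j k l p y

theorem ricci_symm (hG : IsMetricOn G U) (hy : y ∈ U) (k l : Fin n) :
    ricci G l k y = ricci G k l y := by
  have h1 := hG.riemann_trace hy k l
  have h2 := hG.riemann_trace hy l k
  rw [← mtrace_swap (hG.symm y)] at h2
  have : (fun j m => riemann G m l k j y) = fun j m => riemann G j k l m y := by
    funext j m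
    rw [← hG.riemann_pair_symm hy, riemann_swap_left, hG.riemann_swap_right hy, neg_neg]
  rw [this] at h2
  linarith

theorem weyl_swap_left (G : Eu n → Matrix (Fin n) (Fin n) ℝ) (j k l m : Fin n) (y : Eu n) :
    weyl G k j l m y = -weyl G j k l m y := by
  simp only [weyl, riemann_swap_left G j k]
  ring

theorem weyl_swap_right (hG : IsMetricOn G U) (hy : y ∈ U) (j k l m : Fin n) :
    weyl G j k m l y = -weyl G j k l m y := by
  simp only [weyl, hG.riemann_swap_right hy j k l m]
  ring

theorem weyl_pair_symm (hG : IsMetricOn G U) (hy : y ∈ U) (j k l m : Fin n) :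
    weyl G l m j k y = weyl G j k l m y := by
  simp only [weyl, hG.riemann_pair_symm hy j k l m]
  rw [hG.symm y l k, hG.symm y m k, hG.symm y m j, hG.symm y l j, hG.ricci_symm hy k l,
    hG.ricci_symm hy j m, hG.ricci_symm hy k m, hG.ricci_symm hy j l]
  ring

theorem weyl_cyclic (hG : IsMetricOn G U) (hy : y ∈ U) (j k l m : Fin n) :
    weyl G j k l m y + weyl G k l j m y + weyl G l j k m y = 0 := by
  have h := hG.riemann_cyclic j k l m y
  simp only [weyl]
  rw [hG.symm y l k, hG.symm y k j, hG.symm y l j, hG.ricci_symm hy k l,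
    hG.ricci_symm hy j k, hG.ricci_symm hy j l]
  linear_combination h

theorem weyl_trace (hG : IsMetricOn G U) (hn : 2 < n) (hy : y ∈ U) (k l : Fin n) :
    mtrace (G y) (fun j m => weyl G j k l m y) = 0 := by
  have hs := hG.symm y
  have hd := hG.isUnit_det hy
  have hn' : (2 : ℝ) < n := by exact_mod_cast hn
  have h1 : (n : ℝ) - 1 ≠ 0 := by linarith
  have h2 : (n : ℝ) - 2 ≠ 0 := by linarith
  have e1 : mtrace (G y) (fun j m => G y j m * ricci G k l y) = n * ricci G k l y :=
    mtrace_metric_mul hs hd _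
  have e2 : mtrace (G y) (fun j m => G y k m * ricci G j l y) = ricci G k l y :=
    mtrace_metric_right hs hd k fun j => ricci G j l y
  have e3 : mtrace (G y) (fun j m => ricci G j m y * G y k l) = scalarCurv G y * G y k l :=
    mtrace_mul_const _ _
  have e4 : mtrace (G y) (fun j m => ricci G k m y * G y j l) = ricci G k l y := by
    simp only [hs _ l, mul_comm (ricci G k _ y)]
    exact mtrace_metric_left hs hd l fun m => ricci G k m y
  have e5 : mtrace (G y) (fun j m => G y j m * G y k l) = n * G y k l :=
    mtrace_metric_mul hs hd _
  have e6 : mtrace (G y) (fun j m => G y k m * G y j l) = G y k l :=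
    mtrace_metric_right hs hd k fun j => G y j l
  simp only [weyl, div_eq_mul_inv _ (((n : ℝ) - 1) * ((n : ℝ) - 2)), mtrace_sub, mtrace_add,
    mtrace_const_mul, mtrace_mul_const _ (fun j m => scalarCurv G y * _)]
  rw [hG.riemann_trace hy, e1, e2, e3, e4, e5, e6]
  field_simp
  ring

theorem covTwo_metric (hG : IsMetricOn G U) (hy : y ∈ U) (i j k : Fin n) :
    covTwo G i (fun j k z => G z j k) j k y = 0 := by
  have h := congrFun (congrFun (hG.metric_compat hy i) j) k
  simp only [pdMat, Matrix.of_apply, Matrix.add_apply, Matrix.mul_apply, connMat,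
    Matrix.transpose_apply] at h
  simp only [covTwo, h]
  rw [Finset.sum_add_distrib]
  simp only [mul_comm (G y j _)]
  ring

theorem smooth_riemannUp (hG : IsMetricOn G U) (hy : y ∈ U) (j k l m : Fin n) :
    ContDiffAt ℝ ∞ (riemannUp G j k l m) y := hG.smooth_curvMat hy j k m l

theorem smooth_riemann (hG : IsMetricOn G U) (hy : y ∈ U) (j k l m : Fin n) :
    ContDiffAt ℝ ∞ (riemann G j k l m) y :=
  ContDiffAt.sum fun p _ => (hG.smooth_riemannUp hy j k l p).mul (hG.smooth y hy p m)

theorem smooth_ricci (hG : IsMetricOn G U) (hy : y ∈ U) (k l : Fin n) :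
    ContDiffAt ℝ ∞ (ricci G k l) y :=
  (ContDiffAt.sum fun m _ => hG.smooth_riemannUp hy m k l m).neg

theorem smooth_schouten (hG : IsMetricOn G U) (hy : y ∈ U) (k l : Fin n) :
    ContDiffAt ℝ ∞ (schouten G k l) y := by
  have hi := (hG.smooth y hy).inv (hG.det_ne_zero y hy)
  have hs : ContDiffAt ℝ ∞ (scalarCurv G) y :=
    ContDiffAt.sum fun i _ => ContDiffAt.sum fun j _ => (hi i j).mul (hG.smooth_ricci hy i j)
  exact (hG.smooth_ricci hy k l).sub (contDiffAt_const.mul (hs.mul (hG.smooth y hy k l)))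

/-- The second Bianchi identity for the curvature matrices. -/
theorem curvMat_bianchi (hG : IsMetricOn G U) (hy : y ∈ U) (i j k : Fin n) :
    (pdMat i (curvMat G j k) y + connMat G i y * curvMat G j k y
        - curvMat G j k y * connMat G i y)
      + (pdMat j (curvMat G k i) y + connMat G j y * curvMat G k i y
        - curvMat G k i y * connMat G j y)
      + (pdMat k (curvMat G i j) y + connMat G k y * curvMat G i j y
        - curvMat G i j y * connMat G k y) = 0 := by
  have hc := hG.smooth_connMat hy
  have hd : ∀ a b c : Fin n, pdMat a (curvMat G b c) y =
      pdMat a (pdMat c (connMat G b)) y - pdMat a (pdMat b (connMat G c)) y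
        + ((pdMat a (connMat G c) y * connMat G b y + connMat G c y * pdMat a (connMat G b) y)
          - (pdMat a (connMat G b) y * connMat G c y
            + connMat G b y * pdMat a (connMat G c) y)) := by
    intro a b c
    rw [curvMat_eq, pdMat_add a (((hc b).pdMat c).sub ((hc c).pdMat b))
      (((hc c).mul (hc b)).sub ((hc b).mul (hc c))), pdMat_sub a ((hc b).pdMat c) ((hc c).pdMat b),
      pdMat_sub a ((hc c).mul (hc b)) ((hc b).mul (hc c)), pdMat_mul a (hc c) (hc b),
      pdMat_mul a (hc b) (hc c)]
  -- Second derivatives of `Γ` cancel by symmetry; the rest is an identity in a noncommutative ring.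
  rw [hd, hd, hd, pdMat_comm j i (hc k), pdMat_comm k i (hc j), pdMat_comm k j (hc i)]
  simp only [curvMat_eq]
  noncomm_ring

/-- The second Bianchi identity `∇_i R_{jklm} + ∇_j R_{kilm} + ∇_k R_{ijlm} = 0`. -/
theorem riemann_bianchi (hG : IsMetricOn G U) (hy : y ∈ U) (i j k l m : Fin n) :
    covFour G i (riemann G) j k l m y + covFour G j (riemann G) k i l m y
      + covFour G k (riemann G) i j l m y = 0 := by
  -- Metric compatibility absorbs the connection terms on `l` and `m` into the commutator of
  -- `curvMat_bianchi`; only those on the form indices `j, k` are left over.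
  have key : ∀ i j k : Fin n, covFour G i (riemann G) j k l m y =
      (G y * (pdMat i (curvMat G j k) y + connMat G i y * curvMat G j k y
        - curvMat G j k y * connMat G i y)) m l
      - ∑ p, (christoffel G p i j y * riemann G p k l m y
        + christoffel G p i k y * riemann G j p l m y) := by
    intro i j k
    have h1 : pd i (riemann G j k l m) y = pdMat i (fun z => G z * curvMat G j k z) y m l :=
      congrArg (fun f => pd i f y) (funext fun z => hG.riemann_eq j k l m z)
    rw [pdMat_mul i (hG.smooth y hy) (hG.smooth_curvMat hy j k), hG.metric_compat hy] at h1
    have h2 : ∑ p, christoffel G p i l y * riemann G j k p m y =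
        (G y * curvMat G j k y * connMat G i y) m l := by
      simp only [hG.riemann_eq]
      rw [Matrix.mul_apply (M := G y * curvMat G j k y)]
      exact Finset.sum_congr rfl fun p _ => mul_comm _ _
    have h3 : ∑ p, christoffel G p i m y * riemann G j k l p y =
        ((connMat G i y).transpose * (G y * curvMat G j k y)) m l := by
      simp only [hG.riemann_eq]
      rw [Matrix.mul_apply (M := (connMat G i y).transpose)]
      rfl
    simp only [covFour, h1]
    rw [Finset.sum_add_distrib, Finset.sum_add_distrib, h2, h3]
    simp only [Matrix.mul_add, Matrix.mul_sub, Matrix.add_mul, Matrix.add_apply, Matrix.sub_apply,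
      Matrix.mul_assoc]
    ring
  have hb := congrArg (fun A => (G y * A) m l) (hG.curvMat_bianchi hy i j k)
  simp only [Matrix.mul_add, Matrix.add_apply, Matrix.mul_zero, Matrix.zero_apply] at hb
  -- The leftover terms cancel in the cyclic sum because `Γ` is symmetric and `R` is skew in its
  -- first pair.
  have hz : ∑ p, (christoffel G p i j y * riemann G p k l m y
        + christoffel G p i k y * riemann G j p l m y)
      + ∑ p, (christoffel G p j k y * riemann G p i l m y
        + christoffel G p j i y * riemann G k p l m y)
      + ∑ p, (christoffel G p k i y * riemann G p j l m y
        + christoffel G p k j y * riemann G i p l m y) = 0 := by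
    rw [← Finset.sum_add_distrib, ← Finset.sum_add_distrib]
    refine Finset.sum_eq_zero fun p _ => ?_
    rw [hG.christoffel_symm p j i, hG.christoffel_symm p k i, hG.christoffel_symm p k j,
      riemann_swap_left G p k, riemann_swap_left G p j, riemann_swap_left G p i]
    ring
  rw [key, key, key]
  linarith

/-- The cyclic sum of `∇_i C_{jklm}` is of pure trace type. -/
theorem weyl_bianchi (hG : IsMetricOn G U) (hn : 2 < n) (hy : y ∈ U) :
    ∃ P : Fin n → Fin n → Fin n → ℝ, (∀ i k l, P k i l = -P i k l) ∧ ∀ i j k l m,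
      covWeyl G i j k l m y + covWeyl G j k i l m y + covWeyl G k i j l m y =
        G y j m * P i k l + G y k m * P j i l + G y i m * P k j l
          - G y j l * P i k m - G y k l * P j i m - G y i l * P k j m := by
  set c : ℝ := 1 / ((n : ℝ) - 2) with hc
  set b : Fin n → Fin n → Fin n → ℝ := fun i k l => covTwo G i (schouten G) k l y with hb
  -- With `b = ∇S` for the Schouten multiple `S`, this `P` is proportional to the Cotton tensor.
  refine ⟨fun i k l => c * (b i k l - b k i l), fun i k l => by ring, fun i j k l m => ?_⟩
  have dR : ∀ j k l m, DifferentiableAt ℝ (riemann G j k l m) y := fun j k l m =>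
    (hG.smooth_riemann hy j k l m).differentiableAt (by simp)
  have dS : ∀ k l, DifferentiableAt ℝ (schouten G k l) y := fun k l =>
    (hG.smooth_schouten hy k l).differentiableAt (by simp)
  have dG : ∀ k l, DifferentiableAt ℝ (fun z => G z k l) y := (hG.smooth y hy).diff
  have key : ∀ i j k l m, covWeyl G i j k l m y = covFour G i (riemann G) j k l m y +
      c * (G y j m * b i k l - G y k m * b i j l + b i j m * G y k l - b i k m * G y j l) := by
    intro i j k l m
    have h0 : covWeyl G i j k l m y = covFour G i (weyl G) j k l m y := rfl
    have hw : weyl G = fun j k l m z => riemann G j k l m z +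
        c * (G z j m * schouten G k l z - G z k m * schouten G j l z
          + schouten G j m z * G z k l - schouten G k m z * G z j l) := by
      funext j k l m
      exact weyl_eq hn j k l m
    have d1 : ∀ j k l m, DifferentiableAt ℝ (fun z => G z j m * schouten G k l z) y :=
      fun j k l m => (dG j m).fun_mul (dS k l)
    have d2 : ∀ j k l m, DifferentiableAt ℝ (fun z => schouten G j m z * G z k l) y :=
      fun j k l m => (dS j m).fun_mul (dG k l)
    rw [h0, hw, covFour_add i j k l m (dR j k l m)
      (((((d1 j k l m).fun_sub (d1 k j l m)).fun_add (d2 j k l m)).fun_sub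
        (d2 k j l m)).const_mul c),
      covFour_const_mul i j k l m c
      ((((d1 j k l m).fun_sub (d1 k j l m)).fun_add (d2 j k l m)).fun_sub (d2 k j l m)),
      covFour_sub i j k l m (((d1 j k l m).fun_sub (d1 k j l m)).fun_add (d2 j k l m))
        (d2 k j l m),
      covFour_add i j k l m ((d1 j k l m).fun_sub (d1 k j l m)) (d2 j k l m),
      covFour_sub i j k l m (d1 j k l m) (d1 k j l m),
      covFour_outer (S := fun j k z => G z j k) i j k l m (dG j m) (dS k l),
      covFour_outer' (S := fun j k z => G z j k) i j k l m (dG k m) (dS j l),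
      covFour_outer (T := fun j k z => G z j k) i j k l m (dS j m) (dG k l),
      covFour_outer' (T := fun j k z => G z j k) i j k l m (dS k m) (dG j l),
      hG.covTwo_metric hy, hG.covTwo_metric hy, hG.covTwo_metric hy, hG.covTwo_metric hy]
    simp only [hb]
    ring
  have hB := hG.riemann_bianchi hy i j k l m
  rw [key, key, key]
  linear_combination hB

end IsMetricOn

end WeylTensor

/-! ### Pointwise algebra of Weyl-type tensors relative to a null pair. -/

section NullAlgebra

variable {V : Type*} [AddCommGroup V] [Module ℝ V]

theorem exists_ne_zero_orthogonal [FiniteDimensional ℝ V] (hV : 5 ≤ Module.finrank ℝ V) (B : V →ₗ[ℝ] V →ₗ[ℝ] ℝ)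
    (a b c d : V) : ∃ v : V, v ≠ 0 ∧ B a v = 0 ∧ B b v = 0 ∧ B c v = 0 ∧ B d v = 0 := by
  let f : V →ₗ[ℝ] (Fin 4 → ℝ) := LinearMap.pi ![B a, B b, B c, B d]
  have hker : LinearMap.ker f ≠ ⊥ := LinearMap.ker_ne_bot_of_finrank_lt (by simp; omega)
  obtain ⟨v, hv, hv0⟩ := Submodule.exists_mem_ne_zero_of_ne_bot hker
  have h : ∀ i, f v i = 0 := fun i => congrFun (LinearMap.mem_ker.1 hv) i
  exact ⟨v, hv0, h 0, h 1, h 2, h 3⟩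

/-- In a Lorentzian space, vectors orthogonal to a null pair are space-like. -/
theorem pos_of_orthogonal_null_pair {B : V →ₗ[ℝ] V →ₗ[ℝ] ℝ} (hB : ∀ u v, B u v = B v u) {t : V}
    (ht : ∀ v, B t v = 0 → v ≠ 0 → 0 < B v v) {l k v : V} (hl : B l l = 0) (hk : B k k = 0)
    (hlk : B l k = 1) (hlv : B l v = 0) (hkv : B k v = 0) (hv : v ≠ 0) : 0 < B v v := by
  by_contra hneg
  -- If `B v v ≤ 0`, then `B` is negative semidefinite on the span of `v` and the time-like vector
  -- `d`. That span meets the complement of `t` in `s` below, where `B` is positive definite; hence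
  -- `s = 0`, which forces `v = 0`.
  set d := l - k with hd
  have hdd : B d d = -2 := by
    simp only [hd, map_sub, LinearMap.sub_apply, hl, hk, hlk, hB k l]
    norm_num
  have hdv : B d v = 0 := by simp [hd, hlv, hkv]
  have hd0 : d ≠ 0 := by
    intro h
    simp [h] at hdd
  have htd : B t d ≠ 0 := by
    intro h
    linarith [ht d h hd0]
  set s := B t d • v - B t v • d with hs
  have hts : B t s = 0 := by
    simp only [hs, map_sub, map_smul, smul_eq_mul]
    ring
  have hss : B s s = (B t d) ^ 2 * B v v - 2 * (B t v) ^ 2 := by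
    simp only [hs, map_sub, map_smul, LinearMap.sub_apply, LinearMap.smul_apply, smul_eq_mul, hdv,
      hB v d, hdd]
    ring
  have hle : B s s ≤ 0 := by
    rw [hss]
    nlinarith [sq_nonneg (B t d), sq_nonneg (B t v), mul_nonneg (sq_nonneg (B t d)) (by linarith :
      0 ≤ -B v v)]
  have hs0 : s = 0 := by
    by_contra h
    linarith [ht s hts h]
  have hds : B d s = 0 := by simp [hs0]
  have htv : B t v = 0 := by
    simp only [hs, map_sub, map_smul, smul_eq_mul, hdv, hdd] at hds
    linarith
  rw [htv, zero_smul, sub_zero] at hs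
  rw [hs] at hs0
  rcases smul_eq_zero.1 hs0 with h | h
  · exact htd h
  · exact hv h

/-- The algebraic core: a tensor `C` with the symmetries of a Weyl tensor which satisfies the
contracted recurrence identity with respect to a null vector `l` is of type `II_d`, with multiple
null direction `l`. -/
theorem typeIId_of_cyclic_identity [FiniteDimensional ℝ V] (hV : 5 ≤ Module.finrank ℝ V) {B : V →ₗ[ℝ] V →ₗ[ℝ] ℝ}
    (hB : ∀ u v, B u v = B v u) {C : V → V → V → V → ℝ} {N : ℝ} (hN : 4 < N)
    (hl : ∀ j k l m, C k j l m = -C j k l m) (hr : ∀ j k l m, C j k m l = -C j k l m)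
    (hp : ∀ j k l m, C l m j k = C j k l m)
    (hc : ∀ j k l m, C j k l m + C k l j m + C l j k m = 0) {e q : V} (hee : B e e = 0)
    (hqq : B q q = 0) (heq : B e q = 1)
    (hpos : ∀ v, B e v = 0 → B q v = 0 → v ≠ 0 → 0 < B v v)
    (H : ∀ i j k l m, (3 - N) * (B e i * C j k l m + B e j * C k i l m + B e k * C i j l m) =
      B j m * C i k l e + B k m * C j i l e + B i m * C k j l e
        - B j l * C i k m e - B k l * C j i m e - B i l * C k j m e) :
    (∀ u v, B e u = 0 → B q u = 0 → B e v = 0 → B q v = 0 → C e u e v = 0) ∧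
    (∀ u, B e u = 0 → B q u = 0 → C e q e u = 0) ∧
    (∀ u v w, B e u = 0 → B q u = 0 → B e v = 0 → B q v = 0 → B e w = 0 → B q w = 0 →
      C e u v w = 0) ∧
    (∀ u v, B e u = 0 → B q u = 0 → B e v = 0 → B q v = 0 → C e q u v = 0) := by
  have hN3 : N - 3 ≠ 0 := by linarith
  -- boost weight two
  have w1 : ∀ j k l, B e j = 0 → B e k = 0 → B e l = 0 → B k j = 0 → B j l = 0 →
      B j j * C e k e l + B k l * C e j e j = 0 := by
    intro j k l hj hk hl' hkj hjl
    -- Every factor `B e ·` vanishes, so the left side drops out and only the terms with `B j j` and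
    -- `B k l` survive on the right.
    have h := H e j k l j
    rw [hee, hj, hk, hl', hkj, hjl] at h
    linear_combination h + B j j * hr e k e l - B k l * hl e j j e + B k l * hr e j e j
  have w2 : ∀ j, B e j = 0 → B q j = 0 → j ≠ 0 → C e j e j = 0 := by
    intro j hej hqj hj
    -- With `j, p, s` mutually orthogonal, `w1` says that the values `C(e,v,e,v) / B(v,v)` sum to
    -- zero in pairs; three such numbers all vanish.
    obtain ⟨p, hp0, hep, hqp, hjp, -⟩ := exists_ne_zero_orthogonal hV B e q j j
    obtain ⟨s, hs0, hes, hqs, hjs, hps⟩ := exists_ne_zero_orthogonal hV B e q j p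
    have bj := hpos j hej hqj hj
    have bp := hpos p hep hqp hp0
    have bs := hpos s hes hqs hs0
    have h1 := w1 j p p hej hep hep (by rw [hB, hjp]) hjp
    have h2 := w1 p s s hep hes hes (by rw [hB, hps]) hps
    have h3 := w1 j s s hej hes hes (by rw [hB, hjs]) hjs
    have h4 : B p p * B s s * C e j e j = 0 := by
      linear_combination (B s s * h1 + B p p * h3 - B j j * h2) / 2
    simpa [bp.ne', bs.ne'] using h4
  have hW : ∀ u v, B e u = 0 → B e v = 0 → C e u e v = 0 := by
    intro u v hu hv
    -- A transverse `j` orthogonal to `u` and `v` turns `w1` into `B j j * C e u e v = 0`.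
    -- Orthogonality of `u, v` to `q` plays no role.
    obtain ⟨j, hj0, hej, hqj, huj, hvj⟩ := exists_ne_zero_orthogonal hV B e q u v
    have h := w1 j u v hej hu hv huj (by rw [hB, hvj])
    rw [w2 j hej hqj hj0] at h
    simpa [(hpos j hej hqj hj0).ne'] using h
  -- boost weight one
  have v1 : ∀ k l m, B e k = 0 → B q k = 0 → B e l = 0 → B q l = 0 → B e m = 0 → B q m = 0 →
      (N - 3) * C e k l m = B k m * C e q e l - B k l * C e q e m := by
    intro k l m hk hk' hl1 hl2 hm hm'
    have h := H e q k l m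
    rw [hee, heq, hk, hl1, hl2, hm, hm'] at h
    linear_combination h - (3 - N) * hl e k l m + B k m * (hl e q l e - hr e q e l)
      - B k l * (hl e q m e - hr e q e m)
  have hVv : ∀ i, B e i = 0 → B q i = 0 → C e q e i = 0 := by
    intro i hi hi'
    obtain ⟨j, hj0, hej, hqj, hij, -⟩ := exists_ne_zero_orthogonal hV B e q i i
    obtain ⟨k, hk0, hek, hqk, hik, hjk⟩ := exists_ne_zero_orthogonal hV B e q i j
    have bj := hpos j hej hqj hj0
    have bk := hpos k hek hqk hk0
    have hkj : B k j = 0 := by rw [hB, hjk]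
    -- For mutually orthogonal transverse `i, j, k` this gives `B j j * C e k i k + B k k * C e j i
    -- j = 0`. By `v1` both summands equal the same multiple of `C e q e i`, so they add up instead
    -- of cancelling.
    have h := H i j k k j
    rw [hi, hej, hek, hkj, hij, hjk, hik] at h
    have s1 : C i k k e = -C e k i k := by rw [← hp i k k e, hl e k]
    have s2 : C j i j e = C e j i j := by rw [← hp j i j e, hl e j, hr e j i j, neg_neg]
    have h1 := v1 k i k hek hqk hi hi' hek hqk
    have h2 := v1 j i j hej hqj hi hi' hej hqj
    rw [hB k i, hik] at h1
    rw [hB j i, hij] at h2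
    rw [s1, s2] at h
    have h4 : B j j * B k k * C e q e i = 0 := by
      linear_combination ((N - 3) * h - B j j * h1 - B k k * h2) / 2
    simpa [bj.ne', bk.ne'] using h4
  have hZ : ∀ u v w, B e u = 0 → B q u = 0 → B e v = 0 → B q v = 0 → B e w = 0 → B q w = 0 →
      C e u v w = 0 := by
    intro u v w hu hu' hv hv' hw hw'
    have h := v1 u v w hu hu' hv hv' hw hw'
    rw [hVv v hv hv', hVv w hw hw'] at h
    simpa [hN3] using h
  -- boost weight zero
  have f1 : ∀ k l, B e k = 0 → B q k = 0 → B e l = 0 → B q l = 0 →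
      (3 - N) * C e k q l = C e l q k - B k l * C q e q e := by
    intro k l hk hk' hl1 hl2
    have h := H e q k l q
    have s1 : C k e l q = C e k q l := by rw [hl e k, hr e k q l, neg_neg]
    have s2 : C k q l e = C e l q k := by rw [← hp k q l e, hl e l, hr e l q k, neg_neg]
    rw [hee, heq, hk, hqq, hl1, hl2, hB k q, hk', s1, s2] at h
    linear_combination h
  refine ⟨fun u v hu _ hv _ => hW u v hu hv, hVv, hZ, fun u v hu hu' hv hv' => ?_⟩
  have h1 := f1 u v hu hu' hv hv'
  have h2 := f1 v u hv hv' hu hu'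
  rw [hB v u] at h2
  -- The term with `B u v` is symmetric and disappears on antisymmetrising `f1`; the coefficient is
  -- `(3 - N) + 1`.
  have h3 : (4 - N) * (C e u q v - C e v q u) = 0 := by linear_combination h1 - h2
  have h4 : C e u q v - C e v q u = 0 := by
    rcases mul_eq_zero.1 h3 with h | h
    · linarith
    · exact h
  -- The cyclic identity expresses `C e q u v` as `C e u q v - C e v q u`.
  have h5 := hc e q u v
  rw [← hp q u e v, hl e u q v] at h5
  linarith

end NullAlgebra

/-! ### From tensor components to multilinear functions of vectors. -/

section Components

variable {n : ℕ}

/-- The value `C_{jklm} u^j v^k w^l z^m` of a tensor of rank four. -/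
noncomputable def tensorEval (C : Fin n → Fin n → Fin n → Fin n → ℝ) (u v w z : Fin n → ℝ) : ℝ :=
  ∑ j, ∑ k, ∑ l, ∑ m, C j k l m * u j * v k * w l * z m

/-- The value `g_{ij} u^i v^j` of a tensor of rank two. -/
noncomputable def matrixEval (g : Matrix (Fin n) (Fin n) ℝ) (u v : Fin n → ℝ) : ℝ :=
  ∑ i, ∑ j, g i j * u i * v j

variable {C : Fin n → Fin n → Fin n → Fin n → ℝ} {g : Matrix (Fin n) (Fin n) ℝ}

theorem tensorEval_add₁ (u v w z u' : Fin n → ℝ) :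
    tensorEval C (u + u') v w z = tensorEval C u v w z + tensorEval C u' v w z := by
  simp only [tensorEval, Pi.add_apply, mul_add, add_mul, Finset.sum_add_distrib]

theorem tensorEval_smul₁ (c : ℝ) (u v w z : Fin n → ℝ) :
    tensorEval C (c • u) v w z = c * tensorEval C u v w z := by
  simp only [tensorEval, Pi.smul_apply, smul_eq_mul, Finset.mul_sum]
  exact Finset.sum_congr rfl fun j _ => Finset.sum_congr rfl fun k _ =>
    Finset.sum_congr rfl fun l _ => Finset.sum_congr rfl fun m _ => by ring

theorem tensorEval_add₂ (u v w z v' : Fin n → ℝ) :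
    tensorEval C u (v + v') w z = tensorEval C u v w z + tensorEval C u v' w z := by
  simp only [tensorEval, Pi.add_apply, mul_add, add_mul, Finset.sum_add_distrib]

theorem tensorEval_smul₂ (c : ℝ) (u v w z : Fin n → ℝ) :
    tensorEval C u (c • v) w z = c * tensorEval C u v w z := by
  simp only [tensorEval, Pi.smul_apply, smul_eq_mul, Finset.mul_sum]
  exact Finset.sum_congr rfl fun j _ => Finset.sum_congr rfl fun k _ =>
    Finset.sum_congr rfl fun l _ => Finset.sum_congr rfl fun m _ => by ring

theorem tensorEval_add₃ (u v w z w' : Fin n → ℝ) :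
    tensorEval C u v (w + w') z = tensorEval C u v w z + tensorEval C u v w' z := by
  simp only [tensorEval, Pi.add_apply, mul_add, add_mul, Finset.sum_add_distrib]

theorem tensorEval_smul₃ (c : ℝ) (u v w z : Fin n → ℝ) :
    tensorEval C u v (c • w) z = c * tensorEval C u v w z := by
  simp only [tensorEval, Pi.smul_apply, smul_eq_mul, Finset.mul_sum]
  exact Finset.sum_congr rfl fun j _ => Finset.sum_congr rfl fun k _ =>
    Finset.sum_congr rfl fun l _ => Finset.sum_congr rfl fun m _ => by ring

theorem tensorEval_add₄ (u v w z z' : Fin n → ℝ) :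
    tensorEval C u v w (z + z') = tensorEval C u v w z + tensorEval C u v w z' := by
  simp only [tensorEval, Pi.add_apply, mul_add, Finset.sum_add_distrib]

theorem tensorEval_smul₄ (c : ℝ) (u v w z : Fin n → ℝ) :
    tensorEval C u v w (c • z) = c * tensorEval C u v w z := by
  simp only [tensorEval, Pi.smul_apply, smul_eq_mul, Finset.mul_sum]
  exact Finset.sum_congr rfl fun j _ => Finset.sum_congr rfl fun k _ =>
    Finset.sum_congr rfl fun l _ => Finset.sum_congr rfl fun m _ => by ring

theorem matrixEval_add_left (u v u' : Fin n → ℝ) :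
    matrixEval g (u + u') v = matrixEval g u v + matrixEval g u' v := by
  simp only [matrixEval, Pi.add_apply, mul_add, add_mul, Finset.sum_add_distrib]

theorem matrixEval_smul_left (c : ℝ) (u v : Fin n → ℝ) :
    matrixEval g (c • u) v = c * matrixEval g u v := by
  simp only [matrixEval, Pi.smul_apply, smul_eq_mul, Finset.mul_sum]
  exact Finset.sum_congr rfl fun j _ => Finset.sum_congr rfl fun k _ => by ring

theorem matrixEval_add_right (u v v' : Fin n → ℝ) :
    matrixEval g u (v + v') = matrixEval g u v + matrixEval g u v' := by
  simp only [matrixEval, Pi.add_apply, mul_add, Finset.sum_add_distrib]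

theorem matrixEval_smul_right (c : ℝ) (u v : Fin n → ℝ) :
    matrixEval g u (c • v) = c * matrixEval g u v := by
  simp only [matrixEval, Pi.smul_apply, smul_eq_mul, Finset.mul_sum]
  exact Finset.sum_congr rfl fun j _ => Finset.sum_congr rfl fun k _ => by ring

theorem tensorEval_single (j k l m : Fin n) :
    tensorEval C (Pi.single j 1) (Pi.single k 1) (Pi.single l 1) (Pi.single m 1) = C j k l m := by
  simp [tensorEval, Pi.single_apply]

theorem tensorEval_single₃ (j k l : Fin n) (a : Fin n → ℝ) :
    tensorEval C (Pi.single j 1) (Pi.single k 1) (Pi.single l 1) a = ∑ p, C j k l p * a p := by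
  simp [tensorEval, Pi.single_apply]

theorem matrixEval_single (i j : Fin n) :
    matrixEval g (Pi.single i 1) (Pi.single j 1) = g i j := by
  simp [matrixEval, Pi.single_apply]

theorem matrixEval_single_right (a : Fin n → ℝ) (i : Fin n) :
    matrixEval g a (Pi.single i 1) = ∑ p, g p i * a p := by
  simp [matrixEval, Pi.single_apply]

theorem eq_zero_of_isLinearMap {f : (Fin n → ℝ) → ℝ} (hf : IsLinearMap ℝ f)
    (h : ∀ i, f (Pi.single i 1) = 0) (u : Fin n → ℝ) : f u = 0 := by
  have : hf.mk' f = 0 := (Pi.basisFun ℝ (Fin n)).ext fun i => by simpa using h i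
  exact LinearMap.congr_fun this u

/-- Transfers identities from indices to vectors: both sides are multilinear, so comparing them on
basis vectors suffices. -/
theorem eq_zero_of_isLinearMap₄ {f : (Fin n → ℝ) → (Fin n → ℝ) → (Fin n → ℝ) → (Fin n → ℝ) → ℝ}
    (h₁ : ∀ v w z, IsLinearMap ℝ fun u => f u v w z)
    (h₂ : ∀ u w z, IsLinearMap ℝ fun v => f u v w z)
    (h₃ : ∀ u v z, IsLinearMap ℝ fun w => f u v w z)
    (h₄ : ∀ u v w, IsLinearMap ℝ fun z => f u v w z)
    (h : ∀ j k l m, f (Pi.single j 1) (Pi.single k 1) (Pi.single l 1) (Pi.single m 1) = 0)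
    (u v w z : Fin n → ℝ) : f u v w z = 0 :=
  eq_zero_of_isLinearMap (h₁ v w z) (fun j => eq_zero_of_isLinearMap (h₂ _ w z)
    (fun k => eq_zero_of_isLinearMap (h₃ _ _ z)
      (fun l => eq_zero_of_isLinearMap (h₄ _ _ _) (fun m => h j k l m) z) w) v) u

theorem tensorEval_swap_left (h : ∀ j k l m, C k j l m = -C j k l m) (u v w z : Fin n → ℝ) :
    tensorEval C v u w z = -tensorEval C u v w z := by
  simp only [tensorEval, ← Finset.sum_neg_distrib]
  rw [Finset.sum_comm]
  exact Finset.sum_congr rfl fun j _ => Finset.sum_congr rfl fun k _ =>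
    Finset.sum_congr rfl fun l _ => Finset.sum_congr rfl fun m _ => by rw [h]; ring

theorem tensorEval_swap_right (h : ∀ j k l m, C j k m l = -C j k l m) (u v w z : Fin n → ℝ) :
    tensorEval C u v z w = -tensorEval C u v w z := by
  simp only [tensorEval, ← Finset.sum_neg_distrib]
  refine Finset.sum_congr rfl fun j _ => Finset.sum_congr rfl fun k _ => ?_
  rw [Finset.sum_comm]
  exact Finset.sum_congr rfl fun l _ => Finset.sum_congr rfl fun m _ => by rw [h]; ring

theorem tensorEval_pair_symm (h : ∀ j k l m, C l m j k = C j k l m) (u v w z : Fin n → ℝ) :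
    tensorEval C w z u v = tensorEval C u v w z := by
  rw [← sub_eq_zero]
  refine eq_zero_of_isLinearMap₄ (f := fun u v w z => tensorEval C w z u v - tensorEval C u v w z)
    (fun v w z => ⟨?_, ?_⟩) (fun u w z => ⟨?_, ?_⟩) (fun u v z => ⟨?_, ?_⟩)
    (fun u v w => ⟨?_, ?_⟩) (fun j k l m => ?_) u v w z
  on_goal 9 => simp only [tensorEval_single, h j k l m, sub_self]
  all_goals
    intros
    simp only [tensorEval_add₁, tensorEval_add₂, tensorEval_add₃, tensorEval_add₄,
      tensorEval_smul₁, tensorEval_smul₂,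
      tensorEval_smul₃, tensorEval_smul₄, smul_eq_mul]
    ring

theorem tensorEval_cyclic (h : ∀ j k l m, C j k l m + C k l j m + C l j k m = 0)
    (u v w z : Fin n → ℝ) :
    tensorEval C u v w z + tensorEval C v w u z + tensorEval C w u v z = 0 := by
  refine eq_zero_of_isLinearMap₄
    (f := fun u v w z => tensorEval C u v w z + tensorEval C v w u z + tensorEval C w u v z)
    (fun v w z => ⟨?_, ?_⟩) (fun u w z => ⟨?_, ?_⟩) (fun u v z => ⟨?_, ?_⟩)
    (fun u v w => ⟨?_, ?_⟩) (fun j k l m => ?_) u v w z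
  on_goal 9 => simp only [tensorEval_single, h]
  all_goals
    intros
    simp only [tensorEval_add₁, tensorEval_add₂, tensorEval_add₃, tensorEval_add₄,
      tensorEval_smul₁, tensorEval_smul₂,
      tensorEval_smul₃, tensorEval_smul₄, smul_eq_mul]
    ring

/-- The contracted cyclic identity of `cyclic_trace_part`, for vectors instead of indices. -/
theorem tensorEval_cyclic_identity (hs : ∀ i j, g i j = g j i) (hd : IsUnit g.det) (hn : 3 < n)
    {P : Fin n → Fin n → Fin n → ℝ} {α a : Fin n → ℝ}
    (hl : ∀ j k l m, C k j l m = -C j k l m) (hr : ∀ j k l m, C j k m l = -C j k l m)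
    (ht : ∀ k l, mtrace g (fun j m => C j k l m) = 0)
    (hP : ∀ i k l, P k i l = -P i k l) (ha : ∀ i, α i = ∑ p, g p i * a p)
    (H : ∀ i j k l m, α i * C j k l m + α j * C k i l m + α k * C i j l m =
      g j m * P i k l + g k m * P j i l + g i m * P k j l
        - g j l * P i k m - g k l * P j i m - g i l * P k j m) (x u v w z : Fin n → ℝ) :
    (3 - (n : ℝ)) * (matrixEval g a x * tensorEval C u v w z
        + matrixEval g a u * tensorEval C v x w z + matrixEval g a v * tensorEval C x u w z) =
      matrixEval g u z * tensorEval C x v w a + matrixEval g v z * tensorEval C u x w a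
        + matrixEval g x z * tensorEval C v u w a - matrixEval g u w * tensorEval C x v z a
        - matrixEval g v w * tensorEval C u x z a - matrixEval g x w * tensorEval C v u z a := by
  have hA := cyclic_trace_part hs hd hn hl hr ht hP ha H
  set F : (Fin n → ℝ) → (Fin n → ℝ) → (Fin n → ℝ) → (Fin n → ℝ) → (Fin n → ℝ) → ℝ :=
    fun x u v w z => (3 - (n : ℝ)) * (matrixEval g a x * tensorEval C u v w z
        + matrixEval g a u * tensorEval C v x w z + matrixEval g a v * tensorEval C x u w z) -
      (matrixEval g u z * tensorEval C x v w a + matrixEval g v z * tensorEval C u x w a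
        + matrixEval g x z * tensorEval C v u w a - matrixEval g u w * tensorEval C x v z a
        - matrixEval g v w * tensorEval C u x z a - matrixEval g x w * tensorEval C v u z a)
    with hF
  suffices h : F x u v w z = 0 from sub_eq_zero.1 h
  refine eq_zero_of_isLinearMap (f := fun x => F x u v w z) ⟨?_, ?_⟩ (fun i => ?_) x
  on_goal 3 =>
    refine eq_zero_of_isLinearMap₄ (f := F (Pi.single i 1))
      (fun v w z => ⟨?_, ?_⟩) (fun u w z => ⟨?_, ?_⟩) (fun u v z => ⟨?_, ?_⟩)
      (fun u v w => ⟨?_, ?_⟩) (fun j k l m => ?_) u v w z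
    on_goal 9 =>
      simp only [hF, tensorEval_single, matrixEval_single]
      -- On basis vectors, contractions of `C` with `a` become `(3 - n) P`, so the claim is `3 - n`
      -- times `H`.
      simp only [tensorEval_single₃, matrixEval_single_right, ← hA, ← ha]
      linear_combination (3 - (n : ℝ)) * H i j k l m
  all_goals
    intros
    simp only [hF, tensorEval_add₁, tensorEval_add₂, tensorEval_add₃, tensorEval_add₄,
      tensorEval_smul₁, tensorEval_smul₂,
      tensorEval_smul₃, tensorEval_smul₄, matrixEval_add_left,
      matrixEval_add_right, matrixEval_smul_left, matrixEval_smul_right, smul_eq_mul]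
    ring

end Components

/-! ### Charts: components of the metric, covectors and tangent vectors. -/

section Charts

variable {n : ℕ} {M : Type*} [TopologicalSpace M] [ChartedSpace (Eu n) M]
  {φ : OpenPartialHomeomorph M (Eu n)} {x : M}

theorem mdifferentiable_of_mem_maximalAtlas (hφ : φ ∈ IsManifold.maximalAtlas 𝓘(ℝ, Eu n) ∞ M) :
    φ.MDifferentiable 𝓘(ℝ, Eu n) 𝓘(ℝ, Eu n) :=
  ⟨(contMDiffOn_of_mem_maximalAtlas hφ).mdifferentiableOn (by simp),
    (contMDiffOn_symm_of_mem_maximalAtlas hφ).mdifferentiableOn (by simp)⟩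

theorem vecComp_zero (φ : OpenPartialHomeomorph M (Eu n)) (x : M) :
    vecComp φ x (0 : TangentSpace 𝓘(ℝ, Eu n) x) = 0 := by
  funext i
  exact congrArg (fun w : Eu n => w i) (mfderiv 𝓘(ℝ, Eu n) 𝓘(ℝ, Eu n) φ x).map_zero

/-- The vector `coordVec φ i y`, as an element of the model space. -/
noncomputable def coordVecModel (φ : OpenPartialHomeomorph M (Eu n)) (y : Eu n) (i : Fin n) :
    Eu n :=
  coordVec φ i y

/-- The differentials of `φ` and of its inverse compose to the identity; expand `dφ(v)` in the
standard basis and map back. -/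
theorem eq_sum_vecComp (hφ : φ ∈ IsManifold.maximalAtlas 𝓘(ℝ, Eu n) ∞ M) (hx : x ∈ φ.source)
    (v : TangentSpace 𝓘(ℝ, Eu n) x) :
    v = ∑ i, vecComp φ x v i • coordVecModel φ (φ x) i := by
  have h1 := DFunLike.congr_fun
    ((mdifferentiable_of_mem_maximalAtlas hφ).symm_comp_deriv hx) v
  let L : Eu n →L[ℝ] Eu n := mfderiv 𝓘(ℝ, Eu n) 𝓘(ℝ, Eu n) φ.symm (φ x)
  let w : Eu n := mfderiv 𝓘(ℝ, Eu n) 𝓘(ℝ, Eu n) φ x v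
  have h2 : L w = v := h1
  have h3 : w = ∑ i, w i • EuclideanSpace.single i (1 : ℝ) := by
    ext j
    simp [Pi.single_apply]
  rw [h3, map_sum] at h2
  simp only [map_smul] at h2
  exact h2.symm

variable [IsManifold 𝓘(ℝ, Eu n) ∞ M] (g : PseudoMetric n M) (α : CovectorField n M)

theorem PseudoMetric.val_eq_matrixEval (hφ : φ ∈ IsManifold.maximalAtlas 𝓘(ℝ, Eu n) ∞ M)
    (hx : x ∈ φ.source) (u v : TangentSpace 𝓘(ℝ, Eu n) x) :
    g.val x u v = matrixEval (g.comp φ (φ x)) (vecComp φ x u) (vecComp φ x v) := by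
  -- Components are taken at `φ.symm (φ x)`, which equals `x` only propositionally. All tangent
  -- spaces unfold to the model space, so vectors need no transport.
  have base : ∀ x', x' = x → ∀ a b : Eu n,
      (show Eu n →L[ℝ] Eu n →L[ℝ] ℝ from g.val x') a b =
        (show Eu n →L[ℝ] Eu n →L[ℝ] ℝ from g.val x) a b := by
    rintro x' rfl a b
    rfl
  let B : Eu n →L[ℝ] Eu n →L[ℝ] ℝ := g.val x
  have h : B u v = ∑ i, ∑ j, B (coordVecModel φ (φ x) i) (coordVecModel φ (φ x) j) *
      vecComp φ x u i * vecComp φ x v j := by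
    refine (congrArg₂ (fun a b : Eu n => B a b) (eq_sum_vecComp hφ hx u)
      (eq_sum_vecComp hφ hx v)).trans ?_
    simp only [map_sum, map_smul, _root_.sum_apply, _root_.smul_apply, smul_eq_mul, Finset.mul_sum]
    rw [Finset.sum_comm]
    exact Finset.sum_congr rfl fun i _ => Finset.sum_congr rfl fun j _ => by ring
  refine h.trans ?_
  refine Finset.sum_congr rfl fun i _ => Finset.sum_congr rfl fun j _ => ?_
  congr 2
  exact (base _ (φ.left_inv hx) _ _).symm

theorem CovectorField.comp_eq (hφ : φ ∈ IsManifold.maximalAtlas 𝓘(ℝ, Eu n) ∞ M)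
    (hx : x ∈ φ.source) {a : TangentSpace 𝓘(ℝ, Eu n) x} (ha : ∀ v, g.val x a v = α.val x v)
    (i : Fin n) : α.comp φ i (φ x) = ∑ p, g.comp φ (φ x) p i * vecComp φ x a p := by
  have base : ∀ x', x' = x → ∀ a b : Eu n,
      (show Eu n →L[ℝ] Eu n →L[ℝ] ℝ from g.val x') a b =
        (show Eu n →L[ℝ] Eu n →L[ℝ] ℝ from g.val x) a b := by
    rintro x' rfl a b
    rfl
  have base' : ∀ x', x' = x → ∀ b : Eu n,
      (show Eu n →L[ℝ] ℝ from α.val x') b = (show Eu n →L[ℝ] ℝ from α.val x) b := by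
    rintro x' rfl b
    rfl
  let B : Eu n →L[ℝ] Eu n →L[ℝ] ℝ := g.val x
  have h1 : α.comp φ i (φ x) = B a (coordVecModel φ (φ x) i) :=
    (base' _ (φ.left_inv hx) _).trans (ha (coordVecModel φ (φ x) i)).symm
  refine (h1.trans (congrArg (fun b : Eu n => B b (coordVecModel φ (φ x) i))
    (eq_sum_vecComp hφ hx a))).trans ?_
  simp only [map_sum, map_smul, _root_.sum_apply, _root_.smul_apply, smul_eq_mul]
  refine Finset.sum_congr rfl fun p _ => ?_
  rw [mul_comm]
  congr 1
  exact (base _ (φ.left_inv hx) _ _).symm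

/-- Coordinate vector fields are smooth along `φ.symm`, being its differential applied to constant
vectors; pairing them with the smooth section `g` gives a smooth function. -/
theorem PseudoMetric.contDiffAt_comp (hφ : φ ∈ IsManifold.maximalAtlas 𝓘(ℝ, Eu n) ∞ M)
    {y : Eu n} (hy : y ∈ φ.target) (i j : Fin n) :
    ContDiffAt ℝ ∞ (fun z => g.comp φ z i j) y := by
  have hsymm : ContMDiffAt 𝓘(ℝ, Eu n) 𝓘(ℝ, Eu n) ∞ φ.symm y :=
    (contMDiffOn_symm_of_mem_maximalAtlas hφ).contMDiffAt (φ.open_target.mem_nhds hy)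
  have hvec : ∀ i : Fin n, ContMDiffAt 𝓘(ℝ, Eu n) (𝓘(ℝ, Eu n).prod 𝓘(ℝ, Eu n)) ∞
      (fun z => Bundle.TotalSpace.mk' (Eu n) (E := fun x : M => TangentSpace 𝓘(ℝ, Eu n) x)
        (φ.symm z) (coordVec φ i z)) y := by
    intro i
    have hc : ContMDiffAt 𝓘(ℝ, Eu n) (𝓘(ℝ, Eu n).prod 𝓘(ℝ, Eu n)) ∞
        (fun z : Eu n => Bundle.TotalSpace.mk' (Eu n)
          (E := fun x : Eu n => TangentSpace 𝓘(ℝ, Eu n) x) z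
          (EuclideanSpace.single i (1 : ℝ) : Eu n)) y :=
      contMDiffAt_vectorSpace_iff_contDiffAt.2 contDiffAt_const
    exact ContMDiffAt.clm_apply_of_inCoordinates
      (hsymm.mfderiv_const (m := ∞) (by simp)) hc hsymm
  have h := ContMDiffAt.clm_bundle_apply₂ (F₃ := ℝ) (E₃ := Bundle.Trivial M ℝ)
    ((g.contMDiff (φ.symm y)).comp y hsymm) (hvec i) (hvec j)
  rw [Bundle.contMDiffAt_totalSpace] at h
  exact contMDiffAt_iff_contDiffAt.1 h.2

theorem PseudoMetric.isMetricOn_comp (hφ : φ ∈ IsManifold.maximalAtlas 𝓘(ℝ, Eu n) ∞ M) :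
    IsMetricOn (g.comp φ) φ.target where
  isOpen := φ.open_target
  symm y i j := g.symm _ _ _
  smooth y hy i j := g.contDiffAt_comp hφ hy i j
  det_ne_zero y hy := by
    set x := φ.symm y with hx_def
    have hx : x ∈ φ.source := φ.map_target hy
    have hxy : φ x = y := φ.right_inv hy
    intro hdet
    -- A kernel vector of the component matrix lifts through the surjective `dφ` to a vector in the
    -- radical of `g`.
    obtain ⟨v, hv0, hv⟩ := Matrix.exists_mulVec_eq_zero_iff.2 hdet
    obtain ⟨u, hu⟩ :=
      (mdifferentiable_of_mem_maximalAtlas hφ).mfderiv_surjective hx (WithLp.toLp 2 v : Eu n)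
    have huv : vecComp φ x u = v := by
      funext i
      simp only [vecComp]
      rw [hu]
    have hu0 : u = 0 := by
      refine g.nondegenerate x u fun w => ?_
      rw [g.symm, g.val_eq_matrixEval hφ hx, huv, hxy, matrixEval]
      refine Finset.sum_eq_zero fun i _ => ?_
      have h := congrFun hv i
      simp only [Matrix.mulVec, dotProduct, Pi.zero_apply] at h
      simp only [mul_right_comm _ (vecComp φ x w i), ← Finset.sum_mul, h, zero_mul]
    apply hv0
    rw [← huv, hu0]
    exact vecComp_zero φ x

end Charts

end ConfRec

/-! ### The main theorem. -/

theorem mainTheorem8 (n : ℕ) (hn : 5 ≤ n) (M : Type*) [TopologicalSpace M] [T2Space M]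
    [ConnectedSpace M] [ChartedSpace (ConfRec.Eu n) M] [IsManifold 𝓘(ℝ, ConfRec.Eu n) ∞ M]
    (g : ConfRec.PseudoMetric n M) (hg : g.IsLorentzian) (α : ConfRec.CovectorField n M)
    (hrec : g.IsConformallyRecurrent α) (hnull : g.IsNullField α) :
    ∀ x : M, g.IsAlgSpecialAt x ∧ g.IsAtLeastTypeIIdAt x := by
  intro x
  suffices h : g.IsAtLeastTypeIIdAt x by
    obtain ⟨l, k, h1, h2, h3⟩ := h
    exact ⟨⟨l, k, h1, h2⟩, l, k, h1, h2, h3⟩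
  obtain ⟨a, ha, haa⟩ := hnull x
  obtain ⟨k, hkk, hak⟩ : ∃ k, g.val x k k = 0 ∧ g.val x a k = 1 := by
    obtain ⟨w, hw⟩ : ∃ w, g.val x a w ≠ 0 := by
      by_contra! h
      exact hrec.1 x (ContinuousLinearMap.ext fun v => (ha v).symm.trans (h v))
    set c := g.val x a w with hc
    set b := g.val x w w with hb
    -- Rescaling `w` gives product 1 with `a`; adding a multiple of the null vector `a` preserves
    -- this and can be chosen to make the square zero.
    refine ⟨c⁻¹ • w - (c⁻¹ ^ 2 * b / 2) • a, ?_, ?_⟩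
    · have hwa : g.val x w a = c := g.symm x w a
      simp only [map_sub, map_smul, _root_.sub_apply, _root_.smul_apply, smul_eq_mul, haa, hwa,
        ← hc, ← hb]
      field_simp
      ring
    · simp only [map_sub, map_smul, smul_eq_mul, haa, ← hc]
      field_simp
      ring
  let B : TangentSpace 𝓘(ℝ, ConfRec.Eu n) x →ₗ[ℝ] TangentSpace 𝓘(ℝ, ConfRec.Eu n) x →ₗ[ℝ] ℝ :=
    LinearMap.mk₂ ℝ (fun u v => g.val x u v) (by simp) (by simp) (by simp) (by simp)
  have hB : ∀ u v, B u v = g.val x u v := fun u v => rfl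
  have hfd : FiniteDimensional ℝ (TangentSpace 𝓘(ℝ, ConfRec.Eu n) x) :=
    inferInstanceAs (FiniteDimensional ℝ (ConfRec.Eu n))
  have hrank : 5 ≤ Module.finrank ℝ (TangentSpace 𝓘(ℝ, ConfRec.Eu n) x) := by
    have : Module.finrank ℝ (ConfRec.Eu n) = n := finrank_euclideanSpace_fin
    exact hn.trans this.ge
  obtain ⟨t, -, ht⟩ := hg x
  have hpos : ∀ v, B a v = 0 → B k v = 0 → v ≠ 0 → 0 < B v v := fun v h1 h2 hv =>
    ConfRec.pos_of_orthogonal_null_pair (B := B) (g.symm x) ht haa hkk hak h1 h2 hv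
  -- The null pair `a, k` is fixed before the chart, since one pair must serve all charts.
  have core : ∀ φ ∈ IsManifold.maximalAtlas 𝓘(ℝ, ConfRec.Eu n) ∞ M, x ∈ φ.source →
      (∀ u v, B a u = 0 → B k u = 0 → B a v = 0 → B k v = 0 → g.weylAt φ x a u a v = 0) ∧
      (∀ u, B a u = 0 → B k u = 0 → g.weylAt φ x a k a u = 0) ∧
      (∀ u v w, B a u = 0 → B k u = 0 → B a v = 0 → B k v = 0 → B a w = 0 → B k w = 0 →
        g.weylAt φ x a u v w = 0) ∧
      (∀ u v, B a u = 0 → B k u = 0 → B a v = 0 → B k v = 0 → g.weylAt φ x a k u v = 0) := by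
    intro φ hφ hx
    have hG := g.isMetricOn_comp hφ
    have hy : φ x ∈ φ.target := φ.map_source hx
    obtain ⟨P, hP, hbianchi⟩ := hG.weyl_bianchi (by omega) hy
    have hH := ConfRec.tensorEval_cyclic_identity (hG.symm (φ x)) (hG.isUnit_det hy) (by omega)
      (C := fun j k l m => ConfRec.weyl (g.comp φ) j k l m (φ x)) (P := P)
      (α := fun i => α.comp φ i (φ x)) (a := ConfRec.vecComp φ x a)
      (fun j k l m => ConfRec.IsMetricOn.weyl_swap_left _ j k l m _) (hG.weyl_swap_right hy)
      (hG.weyl_trace (by omega) hy) hP (ConfRec.CovectorField.comp_eq g α hφ hx ha)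
      (fun i j k l m => by
        rw [← hbianchi, hrec.2 φ hφ _ hy, hrec.2 φ hφ _ hy, hrec.2 φ hφ _ hy])
    -- `g.weylAt φ x` unfolds to `tensorEval` of the chart components, so the symmetries proved for
    -- indices apply directly.
    exact ConfRec.typeIId_of_cyclic_identity hrank (B := B) (g.symm x) (C := g.weylAt φ x)
      (N := n) (by exact_mod_cast hn)
      (fun u v w z => ConfRec.tensorEval_swap_left
        (fun j k l m => ConfRec.IsMetricOn.weyl_swap_left _ j k l m _) _ _ _ _)
      (fun u v w z => ConfRec.tensorEval_swap_right (hG.weyl_swap_right hy) _ _ _ _)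
      (fun u v w z => ConfRec.tensorEval_pair_symm (hG.weyl_pair_symm hy) _ _ _ _)
      (fun u v w z => ConfRec.tensorEval_cyclic (hG.weyl_cyclic hy) _ _ _ _)
      haa hkk hak hpos (fun x₁ u v w z => by
        simp only [hB, g.val_eq_matrixEval hφ hx]
        exact hH _ _ _ _ _)
  refine ⟨a, k, ⟨haa, hkk, hak⟩, fun φ hφ hx => ?_, fun φ hφ hx u v hu hv => ?_⟩
  · obtain ⟨h1, h2, h3, -⟩ := core φ hφ hx
    exact ⟨fun u v hu hv => h1 u v hu.1 hu.2 hv.1 hv.2, fun u hu => h2 u hu.1 hu.2,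
      fun u v w hu hv hw => h3 u v w hu.1 hu.2 hv.1 hv.2 hw.1 hw.2⟩
  · exact (core φ hφ hx).2.2.2 u v hu.1 hu.2 hv.1 hv.2
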